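/- Let $\Delta\subset\mathbb R^2$ be a Delzant lattice polygon: the convex hull of finitely many points of $\mathbb Z^2$, with nonempty interior, such that at each vertex $v$ exactly two edges meet and these are contained in half-lines $v+t\,w_1(v)$ and $v+t\,w_2(v)$, $t\ge 0$, for some basis $(w_1(v),w_2(v))$ of the lattice $\mathbb Z^2$. Let $V$ and $E$ be the sets of vertices and edges of $\Delta$. For $v\in V$ let $e_i(v)$ be the edge at $v$ directed by $w_i(v)$, and put $$\eta_1(v)=\frac{\langle w_1(v),w_2(v)\rangle}{\|w_1(v)\|^2},\qquad \eta_2(v)=\frac{\langle w_1(v),w_2(v)\rangle}{\|w_2(v)\|^2},\qquad \mu(v)=\eta_1(v)+\eta_2(v).$$ For $e\in E$ let $n_e\in\mathbb Z^2$ be the primitive outward normal vector of $e$, let $(a_e,b_e)$ be any basis of $\mathbb Z^2$ such that $a_e$ is parallel to $e$ and $b_e$ lies in the cone generated by $\{y-x : y\in\Delta,\ x\in e\}$, and put $$\zeta(e)=\frac{\langle b_e,n_e\rangle}{\|n_e\|^2},\qquad \int_e^{*} g=\frac{1}{\|a_e\|}\int_e g\,ds,$$ where $ds$ is arc length. Let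 $B_p$ ($p\ge1$) be the positive Bernoulli numbers $B_1=\frac16$, $B_2=\frac1{30}$, $B_3=\frac1{42},\dots$, i.e. $\frac{s}{1-e^{-s}}=1+\frac s2+\sum_{p\ge1}(-1)^{p-1}B_p\frac{s^{2p}}{(2p)!}$. For vectors $u,w$ write $D^{k+l}f\cdot(u^{k},w^{l})$ for the derivative of order $k+l$ evaluated on $k$ copies of $u$ and $l$ copies of $w$. Then for every $f\in C_0^\infty(\mathbb R^2)$ there is an asymptotic expansion, modulo $O(N^{-\infty})$ as $N\to\infty$, $$\frac1{N^2}\sum_{k\in\mathbb Z^2\cap N\Delta} f\Big(\frac kN\Big)\ \sim\ \sum_{q\ge0}N^{-q}\,T_q(\Delta,f),$$ and its coefficients are: $$T_0(\Delta,f)=\int_\Delta f,\qquad T_1(\Delta,f)=\frac12\sum_{e\in E}\int_e^{*}f,$$ $$T_2(\Delta,f)=\sum_{v\in V}\Big(\frac14+\frac{\mu(v)}{12}\Big)f(v)-\frac1{12}\sum_{e\in E}\zeta(e)\int_e^{*}Df\cdot n_e;$$ for every $p>1$, $T_{2p}(\Delta,f)=\sum_{e\in E}R_{2p}(e,f)+\sum_{v\in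 V}R_{2p}(v,f)$, where $$R_{2p}(e,f)=(-1)^{p}\frac{B_p}{(2p)!}\,\zeta(e)^{2p-1}\int_e^{*}D^{2p-1}f\cdot(n_e^{2p-1}),$$ $$\begin{aligned}R_{2p}(v,f)={}&(-1)^{p}\sum_{m+\ell=p,\ m,\ell\ge1}\frac{B_mB_\ell}{(2m)!\,(2\ell)!}\,D^{2p-2}f(v)\cdot\big(w_1(v)^{2m-1},w_2(v)^{2\ell-1}\big)\\&+(-1)^{p-1}\frac{B_p}{(2p)!}\,\eta_1(v)\sum_{k=0}^{2p-2}\zeta(e_1(v))^k\,D^{2p-2}f(v)\cdot\big(n_{e_1(v)}^{k},w_2(v)^{2p-2-k}\big)\\&+(-1)^{p-1}\frac{B_p}{(2p)!}\,\eta_2(v)\sum_{k=0}^{2p-2}\zeta(e_2(v))^k\,D^{2p-2}f(v)\cdot\big(n_{e_2(v)}^{k},w_1(v)^{2p-2-k}\big);\end{aligned}$$ and for every $p\ge1$, $$T_{2p+1}(\Delta,f)=\frac{(-1)^{p}B_p}{2\,(2p)!}\sum_{v\in V}\Big(D^{2p-1}f(v)\cdot(w_1(v)^{2p-1})+D^{2p-1}f(v)\cdot(w_2(v)^{2p-1})\Big).$$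 -/

import Mathlib

open MeasureTheory Filter Topology Asymptotics
open scoped ContDiff Pointwise InnerProductSpace

noncomputable section

namespace EulerMaclaurin

/-- The Euclidean plane `ℝ²`. -/
abbrev Plane := EuclideanSpace ℝ (Fin 2)

/-- The lattice `ℤ²`, as a subset of the plane. -/
def intPts : Set Plane := {x | ∀ i, ∃ k : ℤ, x i = k}

/-- `(a, b)` is a basis of the lattice `ℤ²`. -/
def IsLatticeBasis (a b : Plane) : Prop :=
  a ∈ intPts ∧ b ∈ intPts ∧
    ∀ x ∈ intPts, ∃! k : ℤ × ℤ, x = (k.1 : ℝ) • a + (k.2 : ℝ) • b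

/-- `n` is a primitive vector of `ℤ²`: it is an integer multiple of a lattice vector only
with factor `±1` (in particular it is nonzero). -/
def IsPrimitive (n : Plane) : Prop :=
  n ∈ intPts ∧ ∀ (k : ℤ) (y : Plane), y ∈ intPts → n = (k : ℝ) • y → IsUnit k

/-- `e` is an edge of `Δ`: a one-dimensional (exposed) face. -/
def IsEdge (Δ e : Set Plane) : Prop :=
  IsExposed ℝ Δ e ∧ Module.finrank ℝ (vectorSpan ℝ e) = 1

/-- The set of edges of `Δ`. -/
def edges (Δ : Set Plane) : Set (Set Plane) := {e | IsEdge Δ e}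

/-- The set of vertices of `Δ`. -/
def vertices (Δ : Set Plane) : Set Plane := Δ.extremePoints ℝ

/-- The part of `Δ` on the half-line `v + t w`, `t ≥ 0`; when `w` points along an edge of `Δ`
at the vertex `v`, this is that edge. -/
def edgeAlong (Δ : Set Plane) (v w : Plane) : Set Plane :=
  {x | x ∈ Δ ∧ ∃ t : ℝ, 0 ≤ t ∧ x = v + t • w}

/-- `(w₁, w₂)` is a basis of `ℤ²`, and exactly two edges of `Δ` meet at `v`, namely one on
each of the half-lines `v + t wᵢ`, `t ≥ 0`. -/
def IsVertexBasis (Δ : Set Plane) (v w₁ w₂ : Plane) : Prop :=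
  IsLatticeBasis w₁ w₂ ∧
    IsEdge Δ (edgeAlong Δ v w₁) ∧ IsEdge Δ (edgeAlong Δ v w₂) ∧
    ∀ e, IsEdge Δ e → v ∈ e → e = edgeAlong Δ v w₁ ∨ e = edgeAlong Δ v w₂

/-- `Δ` is a Delzant lattice polygon: the convex hull of finitely many lattice points, with
nonempty interior, such that at each vertex exactly two edges meet, and these lie on half-lines
directed by the vectors of a basis of `ℤ²`. -/
structure IsDelzantLatticePolygon (Δ : Set Plane) : Prop where
  exists_hull : ∃ S : Set Plane, S.Finite ∧ S ⊆ intPts ∧ Δ = convexHull ℝ S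
  interior_nonempty : (interior Δ).Nonempty
  exists_basis : ∀ v ∈ vertices Δ, ∃ w₁ w₂, IsVertexBasis Δ v w₁ w₂

/-- `n` is the primitive outward normal vector of `Δ` along the edge `e`. -/
def IsOutwardNormal (Δ e : Set Plane) (n : Plane) : Prop :=
  IsPrimitive n ∧ ∀ x ∈ e, ∀ y ∈ Δ, ⟪n, y - x⟫_ℝ ≤ 0

/-- The convex cone generated by the vectors that point from `e` into `Δ`. -/
def coneAt (Δ e : Set Plane) : ConvexCone ℝ Plane :=
  ConvexCone.hull ℝ {z | ∃ x ∈ e, ∃ y ∈ Δ, z = y - x}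

/-- `(a, b)` is a basis of `ℤ²`, with `a` directed along the edge `e` and `b` in the cone of
directions pointing from `e` into `Δ`. -/
def IsEdgeBasis (Δ e : Set Plane) (a b : Plane) : Prop :=
  IsLatticeBasis a b ∧ a ∈ vectorSpan ℝ e ∧ b ∈ coneAt Δ e

/-- The normalised integral over an edge `e` with primitive direction `a`: arc length divided
by the length of `a`. -/
def starIntegral (a : Plane) (e : Set Plane) (g : Plane → ℝ) : ℝ :=
  ‖a‖⁻¹ * ∫ x in e, g x ∂(μH[1] : Measure Plane)

/-- `D^{k+l} f (x) · (u, …, u, w, …, w)`, with `k` copies of `u` followed by `l` copies of `w`. -/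
def mixedDeriv (f : Plane → ℝ) (x : Plane) (k : ℕ) (u : Plane) (l : ℕ) (w : Plane) : ℝ :=
  iteratedFDeriv ℝ (k + l) f x (Fin.append (fun _ : Fin k => u) (fun _ : Fin l => w))

/-- `D^k f (x) · (u, …, u)`. -/
def pureDeriv (f : Plane → ℝ) (x : Plane) (k : ℕ) (u : Plane) : ℝ :=
  iteratedFDeriv ℝ k f x (fun _ => u)

/-- The `p`-th Bernoulli number (`p ≥ 1`) in the convention in which all are positive:
`B₁ = 1/6`, `B₂ = 1/30`, `B₃ = 1/42`, …; thus `s / (1 - exp (-s))` is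
`1 + s / 2 + ∑_{p ≥ 1} (-1)^(p-1) B_p s^(2p) / (2p)!`. -/
def posBernoulli (p : ℕ) : ℝ := (-1) ^ (p - 1) * (bernoulli (2 * p) : ℝ)

/-- The Riemann sum `N⁻² ∑_{k ∈ ℤ² ∩ NΔ} f (k / N)`. -/
def riemannSum (Δ : Set Plane) (f : Plane → ℝ) (N : ℕ) : ℝ :=
  ((N : ℝ) ^ 2)⁻¹ * ∑ᶠ k ∈ intPts ∩ (N : ℝ) • Δ, f ((N : ℝ)⁻¹ • k)

/-- `S N ∼ ∑_{q ≥ 0} T q N^{-q}` as `N → ∞`, modulo `O(N^{-∞})`. -/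
def HasExpansion (S : ℕ → ℝ) (T : ℕ → ℝ) : Prop :=
  ∀ Q : ℕ, (fun N : ℕ => S N - ∑ q ∈ Finset.range Q, T q * ((N : ℝ) ^ q)⁻¹)
    =O[atTop] fun N : ℕ => ((N : ℝ) ^ Q)⁻¹

end EulerMaclaurin

end

/-! The proposed coefficients are additive in `f`, and so are the Riemann sums, so a partition of
unity reduces the expansion to test functions supported near one point `x`
(`IsPolygonFrame.expandsAt`). Near `x`, the polygon is empty, the whole plane, a half-plane bounded
by an edge line, or the unimodular corner at a vertex. In the last three cases a lattice basis and a
lattice point `v` give an affine chart in which `Δ` agrees with a closed quadrant on the support of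
`f`. For interior and edge points, `v` is moved away by lattice vectors so that the superfluous
boundary of the quadrant misses the support.

In such a chart the lattice points of `NΔ` become pairs of natural numbers, and the Riemann sum is
an iterated one-dimensional sum of mesh `1/N`. Classical Euler–Maclaurin, with a remainder uniform
enough to be applied in each variable in turn, gives the quadrant expansion
(`AgreesWithQuadrant.hasExpansion`): its coefficients are an integral over `Δ`, integrals of
transversal derivatives along the two bounding rays, and mixed derivatives at the corner.

The ray integrals at a vertex differentiate along the other basis vector, which depends on the
vertex, so they do not yet glue along an edge. With `w₂ = z + η₁ w₁`, where `z = ζ(e) n_e` is the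
normal component, each `D_{w₂}` may be traded for `D_z`; the tangential part is an exact derivative
and leaves only a value at `v` (`rayIntegral_dirDeriv_iterate`). The vector `z` depends on the edge
alone, because edge bases are unique up to sign and shear (`IsEdgeBasis.unique`). The end-point
values are the `η`-terms of the formula.

Asymptotic coefficients are unique (`HasExpansion.unique`), and the vanishing of the odd Bernoulli
numbers beyond the first brings the coefficients to the stated form. -/

noncomputable section

namespace EulerMaclaurin

/-! ### One-dimensional Euler–Maclaurin with uniform remainder -/

section

/-- The coefficients of the one-dimensional Euler–Maclaurin expansion. -/
def emCoeff (q : ℕ) : ℝ := if q = 0 then 1 else -(bernoulli q / q.factorial)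

/-- The Bernoulli polynomials normalised so that each is a primitive of the previous one. -/
def bernoulliNorm (k : ℕ) (x : ℝ) : ℝ := bernoulliFun k x / k.factorial

/-- `G` is a function `G 0` together with its successive derivatives. -/
def IsDerivChain (G : ℕ → ℝ → ℝ) : Prop := ∀ q t, HasDerivAt (G q) (G (q + 1) t) t

lemma IsDerivChain.continuous {G : ℕ → ℝ → ℝ} (hG : IsDerivChain G) (q : ℕ) :
    Continuous (G q) :=
  continuous_iff_continuousAt.2 fun t => (hG q t).continuousAt

lemma continuous_bernoulliNorm (k : ℕ) : Continuous (bernoulliNorm k) :=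
  (continuous_bernoulliFun k).div_const _

lemma hasDerivAt_bernoulliNorm (k : ℕ) (x : ℝ) :
    HasDerivAt (bernoulliNorm (k + 1)) (bernoulliNorm k x) x := by
  have h := (hasDerivAt_bernoulliFun (k + 1) x).div_const ((k + 1).factorial : ℝ)
  refine h.congr_deriv ?_
  have : (k.factorial : ℝ) ≠ 0 := by positivity
  rw [bernoulliNorm, Nat.factorial_succ, Nat.add_sub_cancel]
  push_cast
  field_simp

/-- Integration by parts. For index at least 2 the Bernoulli polynomial takes equal values at `0`
and `1`, so the boundary term is a multiple of a difference of `G k`, ready to telescope over cells.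
-/
lemma integral_bernoulliNorm_succ {G : ℕ → ℝ → ℝ} (hG : IsDerivChain G) {k : ℕ} (hk : 1 ≤ k) :
    ∫ x in (0 : ℝ)..1, bernoulliNorm k x * G k x =
      -emCoeff (k + 1) * (G k 1 - G k 0) - ∫ x in (0 : ℝ)..1, bernoulliNorm (k + 1) x * G (k + 1) x := by
  have h := intervalIntegral.integral_mul_deriv_eq_deriv_mul (a := 0) (b := 1)
    (u := bernoulliNorm (k + 1)) (u' := bernoulliNorm k) (v := G k) (v' := G (k + 1))
    (fun x _ => hasDerivAt_bernoulliNorm k x) (fun x _ => hG k x)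
    ((continuous_bernoulliNorm k).intervalIntegrable _ _)
    ((hG.continuous (k + 1)).intervalIntegrable _ _)
  have h0 : bernoulliNorm (k + 1) 0 = -emCoeff (k + 1) := by
    simp [bernoulliNorm, emCoeff, bernoulliFun_eval_zero]
  have h1 : bernoulliNorm (k + 1) 1 = -emCoeff (k + 1) := by
    rw [← h0, bernoulliNorm, bernoulliNorm, bernoulliFun_endpoints_eq_of_ne_one (by omega)]
  rw [h0, h1] at h
  linarith

lemma emCoeff_one : emCoeff 1 = 1 / 2 := by
  norm_num [emCoeff, bernoulli_one]

lemma emCoeff_eq_zero {q : ℕ} (hq : Odd q) (h1 : 1 < q) : emCoeff q = 0 := by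
  simp [emCoeff, bernoulli_eq_zero_of_odd hq h1]
  omega

lemma euler_maclaurin_unit {G : ℕ → ℝ → ℝ} (hG : IsDerivChain G) (Q : ℕ) :
    G 0 0 = (∫ x in (0 : ℝ)..1, G 0 x) - ∑ k ∈ Finset.range (Q + 1), emCoeff (k + 1) * (G k 1 - G k 0)
      + (-1) ^ Q * ∫ x in (0 : ℝ)..1, bernoulliNorm (Q + 1) x * G (Q + 1) x := by
  induction Q with
  | zero =>
    -- The first integration by parts is separate: `x - 1/2` takes opposite values at the two ends.
    have h := intervalIntegral.integral_mul_deriv_eq_deriv_mul (a := 0) (b := 1)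
      (u := bernoulliNorm 1) (u' := bernoulliNorm 0) (v := G 0) (v' := G 1)
      (fun x _ => hasDerivAt_bernoulliNorm 0 x) (fun x _ => hG 0 x)
      ((continuous_bernoulliNorm 0).intervalIntegrable _ _)
      ((hG.continuous 1).intervalIntegrable _ _)
    have h0 : bernoulliNorm 0 = fun _ => 1 := by ext x; simp [bernoulliNorm]
    have h1 : ∀ x, bernoulliNorm 1 x = x - 1 / 2 := by intro x; simp [bernoulliNorm]
    simp only [h0, h1, one_mul] at h
    simp only [zero_add, Finset.sum_range_one, emCoeff_one, pow_zero, one_mul, h1]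
    linarith
  | succ Q ih =>
    rw [Finset.sum_range_succ, ih, integral_bernoulliNorm_succ hG (by omega : 1 ≤ Q + 1)]
    -- For odd `Q` the boundary term has the wrong sign, but then its index `Q + 2` is odd and its
    -- Bernoulli number vanishes.
    rcases Nat.even_or_odd Q with h | h
    · rw [pow_succ, h.neg_one_pow]
      ring
    · rw [emCoeff_eq_zero (q := Q + 1 + 1) (by simpa [Nat.odd_add_one] using h) (by omega), pow_succ]
      ring

/-- The Euler–Maclaurin expansion of Riemann sums of mesh `1 / N` over `[0, R]`, for functions that
vanish to the right of `R`, with a uniform bound of the remainder. -/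
theorem exists_euler_maclaurin_bound (Q : ℕ) : ∃ C : ℝ, 0 ≤ C ∧
    ∀ (G : ℕ → ℝ → ℝ), IsDerivChain G → ∀ R N : ℕ, 0 < N →
      (∀ q (t : ℝ), (R : ℝ) ≤ t → G q t = 0) → ∀ M : ℝ, (∀ t, |G (Q + 1) t| ≤ M) →
      |(N : ℝ)⁻¹ * ∑ j ∈ Finset.range (R * N), G 0 (j / N)
        - ((∫ t in (0 : ℝ)..R, G 0 t)
          + ∑ k ∈ Finset.range (Q + 1), emCoeff (k + 1) * (N : ℝ)⁻¹ ^ (k + 1) * G k 0)|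
        ≤ C * R * M * (N : ℝ)⁻¹ ^ (Q + 1) := by
  -- `C` bounds the normalised Bernoulli polynomial on the unit interval, hence depends on `Q` only.
  -- This uniformity lets the bound be used on every row of a double sum.
  obtain ⟨C, hC⟩ := isCompact_Icc.exists_bound_of_continuousOn (s := Set.Icc (0 : ℝ) 1)
    (continuous_bernoulliNorm (Q + 1)).continuousOn
  have hC0 : 0 ≤ C := (norm_nonneg _).trans (hC 0 (by simp))
  refine ⟨C, hC0, fun G hG R N hN hR M hM => ?_⟩
  have hN' : (N : ℝ) ≠ 0 := by positivity
  -- The cell number `j` rescaled to the unit interval; each derivative costs a factor `1/N`.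
  set H : ℕ → ℕ → ℝ → ℝ := fun j q x => (N : ℝ)⁻¹ ^ q * G q ((j + x) * (N : ℝ)⁻¹) with hH
  have hchain : ∀ j, IsDerivChain (H j) := by
    intro j q t
    have h1 : HasDerivAt (fun x : ℝ => (j + x) * (N : ℝ)⁻¹) ((N : ℝ)⁻¹) t := by
      simpa using ((hasDerivAt_id t).const_add (j : ℝ)).mul_const ((N : ℝ)⁻¹)
    have h2 := ((hG q ((j + t) * (N : ℝ)⁻¹)).comp t h1).const_mul ((N : ℝ)⁻¹ ^ q)
    refine h2.congr_deriv ?_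
    simp only [hH]
    ring
  set E : ℕ → ℝ := fun j => ∫ x in (0 : ℝ)..1, bernoulliNorm (Q + 1) x * H j (Q + 1) x with hE
  have hEb : ∀ j, |E j| ≤ C * M * (N : ℝ)⁻¹ ^ (Q + 1) := by
    intro j
    have := intervalIntegral.norm_integral_le_of_norm_le_const (a := 0) (b := 1)
      (f := fun x => bernoulliNorm (Q + 1) x * H j (Q + 1) x)
      (C := C * M * (N : ℝ)⁻¹ ^ (Q + 1)) (fun x hx => ?_)
    · simpa using this
    · rw [Set.uIoc_of_le zero_le_one] at hx
      have h1 := hC x ⟨hx.1.le, hx.2⟩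
      have h2 := hM ((j + x) * (N : ℝ)⁻¹)
      simp only [hH, norm_mul, norm_pow, norm_inv, RCLike.norm_natCast]
      calc _ ≤ C * ((N : ℝ)⁻¹ ^ (Q + 1) * M) := by gcongr; exact h2
        _ = _ := by ring
  have hI : ∀ j : ℕ, ∫ x in (0 : ℝ)..1, H j 0 x =
      N * ∫ t in (j * (N : ℝ)⁻¹)..((j + 1 : ℕ) * (N : ℝ)⁻¹), G 0 t := by
    intro j
    have := intervalIntegral.integral_comp_mul_add (a := 0) (b := 1) (G 0)
      (inv_ne_zero hN') (j * (N : ℝ)⁻¹)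
    simp only [inv_inv, smul_eq_mul, mul_zero, zero_add, mul_one] at this
    simp only [hH, pow_zero, one_mul]
    rw [show ((j + 1 : ℕ) : ℝ) * (N : ℝ)⁻¹ = (N : ℝ)⁻¹ + j * (N : ℝ)⁻¹ by push_cast; ring, ← this]
    congr 1
    ext x
    congr 1
    ring
  have hsumI : ∑ j ∈ Finset.range (R * N), ∫ t in (j * (N : ℝ)⁻¹)..((j + 1 : ℕ) * (N : ℝ)⁻¹), G 0 t
      = ∫ t in (0 : ℝ)..R, G 0 t := by
    rw [intervalIntegral.sum_integral_adjacent_intervals (a := fun j : ℕ => j * (N : ℝ)⁻¹)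
      (fun k _ => (hG.continuous 0).intervalIntegrable _ _)]
    congr 1
    · simp
    · push_cast
      field_simp
  -- The sum over cells telescopes, and the contribution at `R` vanishes by hypothesis.
  have htel : ∀ k, ∑ j ∈ Finset.range (R * N), (H j k 1 - H j k 0) = -((N : ℝ)⁻¹ ^ k * G k 0) := by
    intro k
    have := Finset.sum_range_sub (fun j : ℕ => (N : ℝ)⁻¹ ^ k * G k (j * (N : ℝ)⁻¹)) (R * N)
    have h0 : G k ((R * N : ℕ) * (N : ℝ)⁻¹) = 0 := hR k _ (by push_cast; field_simp; rfl)
    rw [h0] at this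
    simp only [hH, add_zero]
    simpa using this
  have hj : ∀ j : ℕ, G 0 (j / N) = N * (∫ t in (j * (N : ℝ)⁻¹)..((j + 1 : ℕ) * (N : ℝ)⁻¹), G 0 t)
      - ∑ k ∈ Finset.range (Q + 1), emCoeff (k + 1) * (H j k 1 - H j k 0) + (-1) ^ Q * E j := by
    intro j
    have := euler_maclaurin_unit (hchain j) Q
    rw [hI] at this
    rw [← this]
    simp [hH, div_eq_mul_inv]
  have hkey : (N : ℝ)⁻¹ * ∑ j ∈ Finset.range (R * N), G 0 (j / N)
        - ((∫ t in (0 : ℝ)..R, G 0 t)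
          + ∑ k ∈ Finset.range (Q + 1), emCoeff (k + 1) * (N : ℝ)⁻¹ ^ (k + 1) * G k 0)
      = (N : ℝ)⁻¹ * ((-1) ^ Q * ∑ j ∈ Finset.range (R * N), E j) := by
    simp_rw [hj]
    rw [Finset.sum_add_distrib, Finset.sum_sub_distrib, Finset.sum_comm (s := Finset.range (R * N)),
      ← Finset.mul_sum, ← Finset.mul_sum, hsumI]
    simp_rw [← Finset.mul_sum, htel]
    have : (N : ℝ)⁻¹ * ∑ k ∈ Finset.range (Q + 1), emCoeff (k + 1) * -((N : ℝ)⁻¹ ^ k * G k 0)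
        = -∑ k ∈ Finset.range (Q + 1), emCoeff (k + 1) * (N : ℝ)⁻¹ ^ (k + 1) * G k 0 := by
      rw [Finset.mul_sum, ← Finset.sum_neg_distrib]
      exact Finset.sum_congr rfl fun k _ => by ring
    rw [mul_add, mul_sub, this, inv_mul_cancel_left₀ hN']
    ring
  rw [hkey, abs_mul, abs_mul, abs_pow, abs_neg, abs_one, one_pow, one_mul, abs_inv, Nat.abs_cast]
  calc (N : ℝ)⁻¹ * |∑ j ∈ Finset.range (R * N), E j|
      ≤ (N : ℝ)⁻¹ * ∑ j ∈ Finset.range (R * N), C * M * (N : ℝ)⁻¹ ^ (Q + 1) := by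
        gcongr
        exact (Finset.abs_sum_le_sum_abs _ _).trans (Finset.sum_le_sum fun j _ => hEb j)
    _ = C * R * M * (N : ℝ)⁻¹ ^ (Q + 1) := by
        rw [Finset.sum_const, Finset.card_range, nsmul_eq_mul]
        push_cast
        field_simp

end

/-! ### Euler–Maclaurin over a quadrant -/

section

/-- The functionals in the one-dimensional Euler–Maclaurin expansion: the integral over `[0, R]`,
and the derivatives at `0`. -/
def emFunctional (R : ℝ) (G : ℕ → ℝ → ℝ) : ℕ → ℝ
  | 0 => ∫ t in (0 : ℝ)..R, G 0 t
  | k + 1 => G k 0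

/-- `F k l` are the partial derivatives `∂ₛᵏ ∂ₜˡ (F 0 0)` of a smooth function of two variables
that is bounded with all its derivatives and vanishes unless both variables are less than `R`. -/
structure IsDerivArray (R : ℝ) (F : ℕ → ℕ → ℝ → ℝ → ℝ) : Prop where
  fst : ∀ k l s t, HasDerivAt (fun s => F k l s t) (F (k + 1) l s t) s
  snd : ∀ k l s t, HasDerivAt (fun t => F k l s t) (F k (l + 1) s t) t
  continuous : ∀ k l, Continuous (fun p : ℝ × ℝ => F k l p.1 p.2)
  bound : ∀ k l, ∃ M, ∀ s t, |F k l s t| ≤ M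
  vanish_fst : ∀ k l s t, R ≤ s → F k l s t = 0
  vanish_snd : ∀ k l s t, R ≤ t → F k l s t = 0

/-- Counts the integral as the term of index `0`, so that the expansion can be iterated without
separating cases. -/
lemma exists_euler_maclaurin_bound' (Q : ℕ) : ∃ C : ℝ, 0 ≤ C ∧
    ∀ (G : ℕ → ℝ → ℝ), IsDerivChain G → ∀ R N : ℕ, 0 < N →
      (∀ q (t : ℝ), (R : ℝ) ≤ t → G q t = 0) → ∀ M : ℝ, (∀ t, |G (Q + 1) t| ≤ M) →
      |(N : ℝ)⁻¹ * ∑ j ∈ Finset.range (R * N), G 0 (j / N)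
        - ∑ k ∈ Finset.range (Q + 2), emCoeff k * (N : ℝ)⁻¹ ^ k * emFunctional R G k|
        ≤ C * R * M * (N : ℝ)⁻¹ ^ (Q + 1) := by
  obtain ⟨C, hC, h⟩ := exists_euler_maclaurin_bound Q
  refine ⟨C, hC, fun G hG R N hN hR M hM => ?_⟩
  convert h G hG R N hN hR M hM using 3
  rw [Finset.sum_range_succ', add_comm]
  simp [emFunctional, emCoeff]

variable {R : ℝ} {F : ℕ → ℕ → ℝ → ℝ → ℝ}

lemma IsDerivArray.continuous_snd (hF : IsDerivArray R F) (k l : ℕ) (s : ℝ) :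
    Continuous (F k l s) :=
  (hF.continuous k l).comp (by fun_prop : Continuous fun t : ℝ => (s, t))

lemma IsDerivArray.isDerivChain_snd (hF : IsDerivArray R F) (k : ℕ) (s : ℝ) :
    IsDerivChain fun l t => F k l s t :=
  fun l t => hF.snd k l s t

/-- Differentiation under the integral sign. It makes each coefficient of the expansion in `t` a
smooth function of `s`, to which the one-dimensional theorem applies again. -/
lemma IsDerivArray.isDerivChain_functional (hF : IsDerivArray R F) (l : ℕ) :
    IsDerivChain fun k s => emFunctional R (fun q => F k q s) l := by
  intro k s
  cases l with
  | succ l => exact hF.fst k l s 0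
  | zero =>
    obtain ⟨M, hM⟩ := hF.bound (k + 1) 0
    exact (intervalIntegral.hasDerivAt_integral_of_dominated_loc_of_deriv_le (a := 0) (b := R)
      (F := fun s t => F k 0 s t) (F' := fun s t => F (k + 1) 0 s t) (bound := fun _ => M)
      (s := Set.univ) univ_mem
      (Eventually.of_forall fun s => (hF.continuous_snd k 0 s).aestronglyMeasurable)
      ((hF.continuous_snd k 0 s).intervalIntegrable _ _)
      (hF.continuous_snd (k + 1) 0 s).aestronglyMeasurable
      (Eventually.of_forall fun t _ x _ => hM x t) (by simp)
      (Eventually.of_forall fun t _ x _ => hF.fst k 0 x t)).2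

lemma IsDerivArray.functional_eq_zero (hF : IsDerivArray R F) (k l : ℕ) {s : ℝ} (hs : R ≤ s) :
    emFunctional R (fun q => F k q s) l = 0 := by
  cases l with
  | succ l => exact hF.vanish_fst k l s 0 hs
  | zero => simp [emFunctional, hF.vanish_fst k 0 s _ hs]

lemma IsDerivArray.exists_functional_bound (hF : IsDerivArray R F) (k l : ℕ) :
    ∃ M, ∀ s, |emFunctional R (fun q => F k q s) l| ≤ M := by
  cases l with
  | succ l =>
    obtain ⟨M, hM⟩ := hF.bound k l
    exact ⟨M, fun s => hM s 0⟩
  | zero =>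
    obtain ⟨M, hM⟩ := hF.bound k 0
    refine ⟨M * |R - 0|, fun s => ?_⟩
    rw [← Real.norm_eq_abs]
    exact intervalIntegral.norm_integral_le_of_norm_le_const fun t _ => hM s t

/-- The coefficients of the Euler–Maclaurin expansion over a quadrant. -/
def quadrantFunctional (R : ℝ) (F : ℕ → ℕ → ℝ → ℝ → ℝ) (k l : ℕ) : ℝ :=
  emFunctional R (fun k s => emFunctional R (fun q => F k q s) l) k

/-- Each row is expanded in `t` with a remainder uniform in `s`; then the coefficients of that
expansion are themselves summed over `s` and expanded. -/
theorem IsDerivArray.exists_quadrant_bound {R : ℕ} (hF : IsDerivArray R F) (Q : ℕ) :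
    ∃ C : ℝ, ∀ N : ℕ, 0 < N →
      |((N : ℝ) ^ 2)⁻¹ * ∑ i ∈ Finset.range (R * N), ∑ j ∈ Finset.range (R * N), F 0 0 (i / N) (j / N)
        - ∑ k ∈ Finset.range (Q + 2), ∑ l ∈ Finset.range (Q + 2),
          emCoeff k * emCoeff l * quadrantFunctional R F k l * (N : ℝ)⁻¹ ^ (k + l)|
        ≤ C * (N : ℝ)⁻¹ ^ (Q + 1) := by
  obtain ⟨C, hC, h⟩ := exists_euler_maclaurin_bound' Q
  obtain ⟨M, hM⟩ := hF.bound 0 (Q + 1)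
  choose B hB using fun l => hF.exists_functional_bound (Q + 1) l
  -- The first summand collects the row errors (`R * N` rows of weight `1/N`), the second the errors
  -- of the outer expansions.
  refine ⟨R * (C * R * M) + ∑ l ∈ Finset.range (Q + 2), |emCoeff l| * (C * R * B l),
    fun N hN => ?_⟩
  have hN' : (N : ℝ) ≠ 0 := by positivity
  have hN1 : (N : ℝ)⁻¹ ≤ 1 := inv_le_one_of_one_le₀ (by exact_mod_cast hN)
  have hB0 : ∀ l, 0 ≤ B l := fun l => (abs_nonneg _).trans (hB l 0)
  set A : ℕ → ℕ → ℝ → ℝ := fun l k s => emFunctional R (fun q => F k q s) l with hA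
  have h1 : ∀ s, |(N : ℝ)⁻¹ * ∑ j ∈ Finset.range (R * N), F 0 0 s (j / N)
      - ∑ l ∈ Finset.range (Q + 2), emCoeff l * (N : ℝ)⁻¹ ^ l * A l 0 s|
      ≤ C * R * M * (N : ℝ)⁻¹ ^ (Q + 1) := fun s =>
    h _ (hF.isDerivChain_snd 0 s) R N hN (fun q t ht => hF.vanish_snd 0 q s t ht) M (hM s)
  have h2 : ∀ l, |(N : ℝ)⁻¹ * ∑ i ∈ Finset.range (R * N), A l 0 (i / N)
      - ∑ k ∈ Finset.range (Q + 2), emCoeff k * (N : ℝ)⁻¹ ^ k * quadrantFunctional R F k l|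
      ≤ C * R * B l * (N : ℝ)⁻¹ ^ (Q + 1) := fun l =>
    h _ (hF.isDerivChain_functional l) R N hN (fun q t ht => hF.functional_eq_zero q l ht) _ (hB l)
  have hsplit : ((N : ℝ) ^ 2)⁻¹ * ∑ i ∈ Finset.range (R * N), ∑ j ∈ Finset.range (R * N), F 0 0 (i / N) (j / N)
        - ∑ k ∈ Finset.range (Q + 2), ∑ l ∈ Finset.range (Q + 2),
          emCoeff k * emCoeff l * quadrantFunctional R F k l * (N : ℝ)⁻¹ ^ (k + l)
      = (N : ℝ)⁻¹ * ∑ i ∈ Finset.range (R * N),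
          ((N : ℝ)⁻¹ * ∑ j ∈ Finset.range (R * N), F 0 0 (i / N) (j / N)
            - ∑ l ∈ Finset.range (Q + 2), emCoeff l * (N : ℝ)⁻¹ ^ l * A l 0 (i / N))
        + ∑ l ∈ Finset.range (Q + 2), emCoeff l * (N : ℝ)⁻¹ ^ l *
          ((N : ℝ)⁻¹ * ∑ i ∈ Finset.range (R * N), A l 0 (i / N)
            - ∑ k ∈ Finset.range (Q + 2), emCoeff k * (N : ℝ)⁻¹ ^ k * quadrantFunctional R F k l) := by
    rw [Finset.sum_sub_distrib, ← Finset.mul_sum, Finset.sum_comm (s := Finset.range (R * N))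
      (t := Finset.range (Q + 2)), Finset.sum_comm (s := Finset.range (Q + 2))]
    simp_rw [mul_sub, Finset.sum_sub_distrib, Finset.mul_sum]
    rw [← sub_add_sub_cancel (b := ∑ l ∈ Finset.range (Q + 2), ∑ i ∈ Finset.range (R * N),
      (N : ℝ)⁻¹ * (emCoeff l * (N : ℝ)⁻¹ ^ l * A l 0 (i / N)))]
    congr 2
    · exact Finset.sum_congr rfl fun i _ => Finset.sum_congr rfl fun j _ => by ring
    · exact Finset.sum_congr rfl fun i _ => Finset.sum_congr rfl fun j _ => by ring
    · exact Finset.sum_congr rfl fun i _ => Finset.sum_congr rfl fun j _ => by ring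
  rw [hsplit, add_mul]
  refine (abs_add_le _ _).trans (add_le_add ?_ ?_)
  · rw [abs_mul, abs_inv, Nat.abs_cast]
    calc _ ≤ (N : ℝ)⁻¹ * ∑ i ∈ Finset.range (R * N), C * R * M * (N : ℝ)⁻¹ ^ (Q + 1) := by
          gcongr
          exact (Finset.abs_sum_le_sum_abs _ _).trans (Finset.sum_le_sum fun i _ => h1 _)
      _ = _ := by
          rw [Finset.sum_const, Finset.card_range, nsmul_eq_mul]
          push_cast
          field_simp
  · rw [Finset.sum_mul]
    refine (Finset.abs_sum_le_sum_abs _ _).trans (Finset.sum_le_sum fun l _ => ?_)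
    rw [abs_mul, abs_mul, abs_pow, abs_inv, Nat.abs_cast, mul_assoc |emCoeff l|, mul_assoc |emCoeff l|]
    refine mul_le_mul_of_nonneg_left ?_ (abs_nonneg _)
    calc _ ≤ 1 * (C * R * B l * (N : ℝ)⁻¹ ^ (Q + 1)) :=
          mul_le_mul (pow_le_one₀ (by positivity) hN1) (h2 l) (abs_nonneg _) zero_le_one
      _ = _ := by ring

/-- The square of indices contains every antidiagonal of order below `Q`; its remaining terms have
order at least `Q` and are absorbed into the error. -/
lemma hasExpansion_of_double_sum {S : ℕ → ℝ} {x : ℕ → ℕ → ℝ}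
    (h : ∀ Q : ℕ, ∃ C : ℝ, ∀ N : ℕ, 0 < N →
      |S N - ∑ k ∈ Finset.range (Q + 2), ∑ l ∈ Finset.range (Q + 2),
        x k l * (N : ℝ)⁻¹ ^ (k + l)| ≤ C * (N : ℝ)⁻¹ ^ (Q + 1)) :
    HasExpansion S fun q => ∑ p ∈ Finset.HasAntidiagonal.antidiagonal q, x p.1 p.2 := by
  intro Q
  obtain ⟨C, hC⟩ := h Q
  set D := ∑ k ∈ Finset.range (Q + 2), ∑ l ∈ Finset.range (Q + 2), |x k l| with hD
  refine IsBigO.of_bound (|C| + D) ?_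
  filter_upwards [eventually_gt_atTop 0] with N hN
  have hN1 : (N : ℝ)⁻¹ ≤ 1 := inv_le_one_of_one_le₀ (by exact_mod_cast hN)
  have hN0 : (0 : ℝ) ≤ (N : ℝ)⁻¹ := by positivity
  have hdiag : ∑ q ∈ Finset.range Q, (∑ p ∈ Finset.HasAntidiagonal.antidiagonal q, x p.1 p.2) * ((N : ℝ) ^ q)⁻¹
      = ∑ p ∈ Finset.range (Q + 2) ×ˢ Finset.range (Q + 2) with p.1 + p.2 < Q,
          x p.1 p.2 * (N : ℝ)⁻¹ ^ (p.1 + p.2) := by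
    rw [← Finset.sum_fiberwise_of_maps_to (t := Finset.range Q) (g := fun p : ℕ × ℕ => p.1 + p.2)
      (by simp)]
    refine Finset.sum_congr rfl fun q hq => ?_
    rw [Finset.sum_mul]
    refine Finset.sum_congr ?_ ?_
    · ext ⟨k, l⟩
      simp at hq ⊢
      omega
    · intro p hp
      simp at hp
      rw [← hp.2, inv_pow]
  have hall : ∑ k ∈ Finset.range (Q + 2), ∑ l ∈ Finset.range (Q + 2), x k l * (N : ℝ)⁻¹ ^ (k + l)
      = ∑ q ∈ Finset.range Q, (∑ p ∈ Finset.HasAntidiagonal.antidiagonal q, x p.1 p.2) * ((N : ℝ) ^ q)⁻¹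
        + ∑ p ∈ Finset.range (Q + 2) ×ˢ Finset.range (Q + 2) with ¬ p.1 + p.2 < Q,
          x p.1 p.2 * (N : ℝ)⁻¹ ^ (p.1 + p.2) := by
    rw [hdiag, Finset.sum_filter_add_sum_filter_not, Finset.sum_product]
  have hrest : |∑ p ∈ Finset.range (Q + 2) ×ˢ Finset.range (Q + 2) with ¬ p.1 + p.2 < Q,
          x p.1 p.2 * (N : ℝ)⁻¹ ^ (p.1 + p.2)| ≤ D * (N : ℝ)⁻¹ ^ Q := by
    rw [hD, ← Finset.sum_product', Finset.sum_mul]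
    refine (Finset.abs_sum_le_sum_abs _ _).trans ?_
    refine (Finset.sum_le_sum (g := fun p => |x p.1 p.2| * (N : ℝ)⁻¹ ^ Q) fun p hp => ?_).trans
      (Finset.sum_le_sum_of_subset_of_nonneg (Finset.filter_subset _ _)
        fun _ _ _ => by positivity)
    simp only [Finset.mem_filter, not_lt] at hp
    rw [abs_mul, abs_pow, abs_inv, Nat.abs_cast]
    exact mul_le_mul_of_nonneg_left (pow_le_pow_of_le_one hN0 hN1 hp.2) (abs_nonneg _)
  have hfirst := hC N hN
  rw [hall] at hfirst
  rw [Real.norm_eq_abs, norm_inv, norm_pow, RCLike.norm_natCast, ← inv_pow, add_mul]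
  have h3 : C * (N : ℝ)⁻¹ ^ (Q + 1) ≤ |C| * (N : ℝ)⁻¹ ^ Q :=
    mul_le_mul (le_abs_self C) (pow_le_pow_of_le_one hN0 hN1 (Nat.le_succ Q)) (by positivity)
      (abs_nonneg C)
  rw [← sub_sub] at hfirst
  calc _ = |_ - _ + _| := by rw [sub_add_cancel]
    _ ≤ _ := (abs_add_le _ _).trans (add_le_add (hfirst.trans h3) hrest)

/-- The Euler–Maclaurin expansion over a quadrant. -/
theorem IsDerivArray.hasExpansion {R : ℕ} (hF : IsDerivArray R F) :
    HasExpansion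
      (fun N => ((N : ℝ) ^ 2)⁻¹ *
        ∑ i ∈ Finset.range (R * N), ∑ j ∈ Finset.range (R * N), F 0 0 (i / N) (j / N))
      fun q => ∑ p ∈ Finset.HasAntidiagonal.antidiagonal q,
        emCoeff p.1 * emCoeff p.2 * quadrantFunctional R F p.1 p.2 :=
  hasExpansion_of_double_sum hF.exists_quadrant_bound

end

/-! ### Iterated directional derivatives and integrals along rays -/

section

/-- The derivative of `f` in the direction `w`, as a function. -/
def dirDeriv (w : Plane) (f : Plane → ℝ) : Plane → ℝ := fun x => fderiv ℝ f x w

/-- Smooth functions with compact support. -/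
structure IsTest (f : Plane → ℝ) : Prop where
  smooth : ContDiff ℝ ∞ f
  compact : HasCompactSupport f

section dirDeriv

variable {f g : Plane → ℝ}

lemma contDiff_dirDeriv (hf : ContDiff ℝ ∞ f) (w : Plane) : ContDiff ℝ ∞ (dirDeriv w f) :=
  (hf.fderiv_right (m := ∞) (by simp)).clm_apply contDiff_const

lemma contDiff_dirDeriv_iterate (hf : ContDiff ℝ ∞ f) (w : Plane) (k : ℕ) :
    ContDiff ℝ ∞ ((dirDeriv w)^[k] f) := by
  induction k with
  | zero => exact hf
  | succ k ih => rw [Function.iterate_succ_apply']; exact contDiff_dirDeriv ih w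

lemma tsupport_dirDeriv_subset (w : Plane) (f : Plane → ℝ) :
    tsupport (dirDeriv w f) ⊆ tsupport f :=
  tsupport_fderiv_apply_subset ℝ w

lemma tsupport_dirDeriv_iterate_subset (w : Plane) (f : Plane → ℝ) (k : ℕ) :
    tsupport ((dirDeriv w)^[k] f) ⊆ tsupport f := by
  induction k with
  | zero => exact subset_rfl
  | succ k ih =>
    rw [Function.iterate_succ_apply']
    exact (tsupport_dirDeriv_subset w _).trans ih

lemma IsTest.dirDeriv (hf : IsTest f) (w : Plane) : IsTest (dirDeriv w f) :=
  ⟨contDiff_dirDeriv hf.smooth w, hf.compact.fderiv_apply ℝ w⟩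

lemma IsTest.iterate (hf : IsTest f) (w : Plane) (k : ℕ) :
    IsTest ((EulerMaclaurin.dirDeriv w)^[k] f) := by
  induction k with
  | zero => exact hf
  | succ k ih => rw [Function.iterate_succ_apply']; exact ih.dirDeriv w

lemma dirDeriv_comm (hf : ContDiff ℝ ∞ f) (u w : Plane) :
    dirDeriv u (dirDeriv w f) = dirDeriv w (dirDeriv u f) := by
  ext x
  have hd : DifferentiableAt ℝ (fderiv ℝ f) x :=
    ((hf.fderiv_right (m := ∞) (by simp)).differentiable (by simp)) x
  have h : IsSymmSndFDerivAt ℝ f x := (hf.contDiffAt).isSymmSndFDerivAt (by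
    simp only [minSmoothness_of_isRCLikeNormedField]
    exact WithTop.coe_le_coe.2 (le_top (a := (2 : ℕ∞))))
  have key : ∀ a b : Plane, dirDeriv a (dirDeriv b f) x = fderiv ℝ (fderiv ℝ f) x a b := by
    intro a b
    change fderiv ℝ (fun y => fderiv ℝ f y b) x a = _
    rw [fderiv_clm_apply hd (differentiableAt_const b)]
    simp
  rw [key, key, h.eq]

lemma dirDeriv_iterate_comm (hf : ContDiff ℝ ∞ f) (u w : Plane) (k : ℕ) :
    dirDeriv u ((dirDeriv w)^[k] f) = (dirDeriv w)^[k] (dirDeriv u f) := by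
  induction k with
  | zero => rfl
  | succ k ih =>
    rw [Function.iterate_succ_apply', Function.iterate_succ_apply', ← ih,
      dirDeriv_comm (contDiff_dirDeriv_iterate hf w k)]

lemma dirDeriv_add (hf : ContDiff ℝ ∞ f) (hg : ContDiff ℝ ∞ g) (w : Plane) :
    dirDeriv w (f + g) = dirDeriv w f + dirDeriv w g := by
  ext x
  simp [dirDeriv, fderiv_add (hf.differentiable (by simp) x) (hg.differentiable (by simp) x)]

lemma dirDeriv_iterate_add (hf : ContDiff ℝ ∞ f) (hg : ContDiff ℝ ∞ g) (w : Plane) (k : ℕ) :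
    (dirDeriv w)^[k] (f + g) = (dirDeriv w)^[k] f + (dirDeriv w)^[k] g := by
  induction k with
  | zero => rfl
  | succ k ih =>
    simp only [Function.iterate_succ_apply']
    rw [ih, dirDeriv_add (contDiff_dirDeriv_iterate hf w k) (contDiff_dirDeriv_iterate hg w k)]

lemma dirDeriv_const_smul (hf : ContDiff ℝ ∞ f) (c : ℝ) (w : Plane) :
    dirDeriv w (c • f) = c • dirDeriv w f := by
  ext x
  simp [dirDeriv, fderiv_const_smul (hf.differentiable (by simp) x)]

lemma dirDeriv_smul_iterate (hf : ContDiff ℝ ∞ f) (c : ℝ) (w : Plane) (k : ℕ) :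
    (dirDeriv (c • w))^[k] f = c ^ k • (dirDeriv w)^[k] f := by
  have h1 : ∀ g : Plane → ℝ, dirDeriv (c • w) g = c • dirDeriv w g := fun g => by
    ext x; simp [dirDeriv]
  induction k with
  | zero => simp
  | succ k ih =>
    rw [Function.iterate_succ_apply', ih, h1,
      dirDeriv_const_smul (contDiff_dirDeriv_iterate hf w k), Function.iterate_succ_apply',
      smul_smul, pow_succ']

/-- Bridge from the multilinear derivatives of the statement to compositions of the commuting
operators `dirDeriv`, in which the algebra is carried out. -/
lemma iteratedFDeriv_eq_foldr (hf : ContDiff ℝ ∞ f) (n : ℕ) (m : Fin n → Plane) :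
    (fun x => iteratedFDeriv ℝ n f x m) = (List.ofFn m).foldr dirDeriv f := by
  induction n with
  | zero => ext x; simp
  | succ n ih =>
    ext x
    have hd : DifferentiableAt ℝ (iteratedFDeriv ℝ n f) x :=
      (hf.differentiable_iteratedFDeriv (by exact_mod_cast WithTop.coe_lt_top _)) x
    rw [hd.iteratedFDeriv_succ_apply_left', ih (Fin.tail m), List.ofFn_succ, List.foldr_cons]
    rfl

lemma foldr_replicate_dirDeriv (w : Plane) (k : ℕ) (f : Plane → ℝ) :
    (List.replicate k w).foldr dirDeriv f = (dirDeriv w)^[k] f := by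
  induction k with
  | zero => rfl
  | succ k ih => rw [List.replicate_succ, List.foldr_cons, ih, Function.iterate_succ_apply']

lemma pureDeriv_eq (hf : ContDiff ℝ ∞ f) (x : Plane) (k : ℕ) (u : Plane) :
    pureDeriv f x k u = (dirDeriv u)^[k] f x := by
  have := congrFun (iteratedFDeriv_eq_foldr hf k fun _ => u) x
  rwa [List.ofFn_const, foldr_replicate_dirDeriv] at this

lemma mixedDeriv_eq (hf : ContDiff ℝ ∞ f) (x : Plane) (k : ℕ) (u : Plane) (l : ℕ) (w : Plane) :
    mixedDeriv f x k u l w = (dirDeriv u)^[k] ((dirDeriv w)^[l] f) x := by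
  have := congrFun (iteratedFDeriv_eq_foldr hf (k + l)
    (Fin.append (fun _ : Fin k => u) (fun _ : Fin l => w))) x
  rwa [List.ofFn_fin_append, List.foldr_append, List.ofFn_const, List.ofFn_const,
    foldr_replicate_dirDeriv, foldr_replicate_dirDeriv] at this

end dirDeriv

/-- The integral of `g` along the ray from `v` in the direction `w`, with respect to the
parameter `t` of `v + t w`. -/
def rayIntegral (v w : Plane) (g : Plane → ℝ) : ℝ := ∫ t in Set.Ioi (0 : ℝ), g (v + t • w)

section rayIntegral

variable {f g : Plane → ℝ} {v w : Plane}

lemma isClosedEmbedding_line (hw : w ≠ 0) (v : Plane) :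
    IsClosedEmbedding fun t : ℝ => v + t • w :=
  (Homeomorph.addLeft v).isClosedEmbedding.comp (isClosedEmbedding_smul_left hw)

lemma hasCompactSupport_line (hf : HasCompactSupport f) (hw : w ≠ 0) (v : Plane) :
    HasCompactSupport fun t : ℝ => f (v + t • w) :=
  hf.comp_isClosedEmbedding (isClosedEmbedding_line hw v)

lemma integrable_line (hf : Continuous f) (hc : HasCompactSupport f) (hw : w ≠ 0) (v : Plane) :
    Integrable fun t : ℝ => f (v + t • w) :=
  (hf.comp (by fun_prop)).integrable_of_hasCompactSupport (hasCompactSupport_line hc hw v)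

lemma hasDerivAt_line (hf : ContDiff ℝ ∞ f) (v w : Plane) (t : ℝ) :
    HasDerivAt (fun t : ℝ => f (v + t • w)) (dirDeriv w f (v + t • w)) t := by
  have h1 : HasDerivAt (fun t : ℝ => v + t • w) w t := by
    simpa using ((hasDerivAt_id t).smul_const w).const_add v
  exact ((hf.differentiable (by simp) (v + t • w)).hasFDerivAt).comp_hasDerivAt t h1

lemma rayIntegral_add (hf : IsTest f) (hg : IsTest g) (hw : w ≠ 0) (v : Plane) :
    rayIntegral v w (f + g) = rayIntegral v w f + rayIntegral v w g :=
  integral_add (integrable_line hf.smooth.continuous hf.compact hw v).integrableOn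
    (integrable_line hg.smooth.continuous hg.compact hw v).integrableOn

lemma rayIntegral_const_smul (c : ℝ) : rayIntegral v w (c • f) = c * rayIntegral v w f :=
  integral_const_mul c _

/-- Fundamental theorem of calculus; compact support removes the end at infinity. -/
lemma rayIntegral_dirDeriv (hf : IsTest f) (hw : w ≠ 0) (v : Plane) :
    rayIntegral v w (dirDeriv w f) = -f v := by
  have h := (hasCompactSupport_line hf.compact hw v).integral_Ioi_deriv_eq
    ((hf.smooth.comp (by fun_prop : ContDiff ℝ ∞ fun t : ℝ => v + t • w)).of_le (by simp)) 0
  have h2 : (deriv fun t : ℝ => f (v + t • w)) = fun t => dirDeriv w f (v + t • w) :=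
    funext fun t => (hasDerivAt_line hf.smooth v w t).deriv
  change ∫ t in Set.Ioi (0 : ℝ), deriv (fun t : ℝ => f (v + t • w)) t = -f (v + (0 : ℝ) • w) at h
  rw [h2] at h
  simpa [rayIntegral] using h

/-- Along an edge, transversal derivatives are reduced to derivatives in another transversal
direction, up to terms at the end point. -/
lemma rayIntegral_dirDeriv_iterate {u z : Plane} {η : ℝ} (hw : w ≠ 0) (hu : u = z + η • w)
    (hf : IsTest f) (n : ℕ) (v : Plane) :
    rayIntegral v w ((dirDeriv u)^[n] f) = rayIntegral v w ((dirDeriv z)^[n] f)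
      - η * ∑ k ∈ Finset.range n, (dirDeriv z)^[k] ((dirDeriv u)^[n - 1 - k] f) v := by
  induction n generalizing f with
  | zero => simp
  | succ n ih =>
    -- One factor `D_u` is split; the `D_z` part goes to the induction hypothesis for `D_z f`, while
    -- the `D_w` part integrates to a value at `v`.
    have h1 : ∀ g, dirDeriv u g = dirDeriv z g + η • dirDeriv w g := by
      intro g; ext x; simp [dirDeriv, hu]
    have hw' : IsTest (η • dirDeriv w ((dirDeriv u)^[n] f)) :=
      ⟨((hf.iterate u n).dirDeriv w).smooth.const_smul η,
        ((hf.iterate u n).dirDeriv w).compact.smul_left (f := fun _ => η)⟩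
    rw [Function.iterate_succ_apply', h1, dirDeriv_iterate_comm hf.smooth,
      rayIntegral_add ((hf.dirDeriv z).iterate u n) hw' hw, ih (hf.dirDeriv z),
      rayIntegral_const_smul, rayIntegral_dirDeriv (hf.iterate u n) hw, Finset.sum_range_succ']
    simp only [Function.iterate_succ_apply, Function.iterate_zero, id]
    have : ∀ k, (dirDeriv z)^[k] ((dirDeriv u)^[n - 1 - k] (dirDeriv z f)) v =
      (dirDeriv z)^[k] (dirDeriv z ((dirDeriv u)^[n + 1 - 1 - (k + 1)] f)) v := by
      intro k
      rw [dirDeriv_iterate_comm hf.smooth, (by omega : n + 1 - 1 - (k + 1) = n - 1 - k)]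
    simp only [this, Nat.add_sub_cancel, Nat.sub_zero]
    ring

end rayIntegral

end

/-! ### Lattice bases and unimodular charts -/

section

/-- The determinant of two vectors of the plane. -/
def cross (x y : Plane) : ℝ := x 0 * y 1 - x 1 * y 0

lemma plane_ext {x y : Plane} (h0 : x 0 = y 0) (h1 : x 1 = y 1) : x = y := by
  ext i; fin_cases i
  · exact h0
  · exact h1

/-- Cramer's rule, kept free of division. -/
lemma cross_smul_eq (u w x : Plane) : cross u w • x = cross x w • u + cross u x • w := by
  apply plane_ext <;> simp [cross] <;> ring

lemma cross_combination (u w : Plane) (a b c d : ℝ) :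
    cross (a • u + b • w) (c • u + d • w) = (a * d - b * c) * cross u w := by
  simp [cross]; ring

lemma cross_add_smul_right (u w : Plane) (s t : ℝ) :
    cross (s • u + t • w) w = s * cross u w := by
  simp [cross]; ring

lemma cross_add_smul_left (u w : Plane) (s t : ℝ) :
    cross u (s • u + t • w) = t * cross u w := by
  simp [cross]; ring

lemma intPts_zero_mem : (0 : Plane) ∈ intPts := fun i => ⟨0, by simp⟩

lemma intPts_add {x y : Plane} (hx : x ∈ intPts) (hy : y ∈ intPts) : x + y ∈ intPts := by
  intro i
  obtain ⟨k, hk⟩ := hx i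
  obtain ⟨l, hl⟩ := hy i
  exact ⟨k + l, by simp [hk, hl]⟩

lemma intPts_smul {x : Plane} (hx : x ∈ intPts) (m : ℤ) : (m : ℝ) • x ∈ intPts := by
  intro i
  obtain ⟨k, hk⟩ := hx i
  exact ⟨m * k, by simp [hk]⟩

lemma intPts_sub {x y : Plane} (hx : x ∈ intPts) (hy : y ∈ intPts) : x - y ∈ intPts := by
  have := intPts_add hx (intPts_smul hy (-1))
  simpa [sub_eq_add_neg] using this

namespace IsLatticeBasis

variable {u w : Plane}

/-- The standard unit vectors are integer combinations of the basis, so its integer determinant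
divides `1`. -/
lemma cross_eq (h : IsLatticeBasis u w) : cross u w = 1 ∨ cross u w = -1 := by
  obtain ⟨hu, hw, hs⟩ := h
  obtain ⟨k, hk, -⟩ := hs (EuclideanSpace.single 0 1) (fun i => by
    fin_cases i
    · exact ⟨1, by simp⟩
    · exact ⟨0, by simp⟩)
  obtain ⟨l, hl, -⟩ := hs (EuclideanSpace.single 1 1) (fun i => by
    fin_cases i
    · exact ⟨0, by simp⟩
    · exact ⟨1, by simp⟩)
  obtain ⟨a, ha⟩ := hu 0
  obtain ⟨b, hb⟩ := hu 1
  obtain ⟨c, hc⟩ := hw 0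
  obtain ⟨d, hd⟩ := hw 1
  have h1 := cross_combination u w k.1 k.2 l.1 l.2
  rw [← hk, ← hl] at h1
  simp only [cross, ha, hb, hc, hd] at h1 ⊢
  simp at h1
  have h2 : (k.1 * l.2 - k.2 * l.1) * (a * d - b * c) = (1 : ℤ) := by exact_mod_cast h1.symm
  rcases Int.isUnit_iff.1 (IsUnit.of_mul_eq_one_right _ h2) with h3 | h3
  · left; exact_mod_cast h3
  · right; exact_mod_cast h3

lemma cross_mul_self (h : IsLatticeBasis u w) : cross u w * cross u w = 1 := by
  rcases h.cross_eq with h | h <;> simp [h]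

lemma cross_ne_zero (h : IsLatticeBasis u w) : cross u w ≠ 0 := by
  rcases h.cross_eq with h | h <;> simp [h]

lemma fst_ne_zero (h : IsLatticeBasis u w) : u ≠ 0 := by
  rintro rfl
  exact h.cross_ne_zero (by simp [cross])

lemma snd_ne_zero (h : IsLatticeBasis u w) : w ≠ 0 := by
  rintro rfl
  exact h.cross_ne_zero (by simp [cross])

/-- The determinant is its own inverse, so Cramer's rule gives the coordinates by multiplication
instead of division. -/
lemma eq_combination (h : IsLatticeBasis u w) (x : Plane) :
    x = (cross u w * cross x w) • u + (cross u w * cross u x) • w := by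
  rw [mul_smul, mul_smul, ← smul_add, ← cross_smul_eq, smul_smul, h.cross_mul_self, one_smul]

lemma combination_inj (h : IsLatticeBasis u w) {s t s' t' : ℝ}
    (he : s • u + t • w = s' • u + t' • w) : s = s' ∧ t = t' := by
  have h1 := congrArg (fun x => cross x w) he
  have h2 := congrArg (cross u) he
  simp only [cross_add_smul_right, cross_add_smul_left] at h1 h2
  exact ⟨mul_right_cancel₀ h.cross_ne_zero h1, mul_right_cancel₀ h.cross_ne_zero h2⟩

end IsLatticeBasis

/-- The affine parametrisation of the plane with origin `v` and directions `u`, `w`. -/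
def chart (v u w : Plane) (p : ℝ × ℝ) : Plane := v + p.1 • u + p.2 • w

lemma continuous_chart (v u w : Plane) : Continuous (chart v u w) := by
  unfold chart; fun_prop

lemma chart_injective {u w : Plane} (h : IsLatticeBasis u w) (v : Plane) :
    Function.Injective (chart v u w) := by
  rintro ⟨s, t⟩ ⟨s', t'⟩ he
  simp only [chart, add_assoc, add_right_inj] at he
  obtain ⟨rfl, rfl⟩ := h.combination_inj he
  rfl

/-- A linear map of determinant `±1` followed by a translation: no Jacobian enters the leading
coefficient. -/
lemma measurePreserving_chart {u w : Plane} (h : IsLatticeBasis u w) (v : Plane) :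
    MeasurePreserving (chart v u w) := by
  let A : Plane →ₗ[ℝ] Plane :=
    { toFun := fun x => x 0 • u + x 1 • w
      map_add' := fun x y => by simp [add_smul]; abel
      map_smul' := fun c x => by simp [smul_smul] }
  have hdet : LinearMap.det A = cross u w := by
    rw [← LinearMap.det_toMatrix (EuclideanSpace.basisFun (Fin 2) ℝ).toBasis, Matrix.det_fin_two]
    have hA : ∀ x, A x = x 0 • u + x 1 • w := fun _ => rfl
    simp [LinearMap.toMatrix_apply, hA, cross]
    ring
  have hA : MeasurePreserving A := by
    refine ⟨A.continuous_of_finiteDimensional.measurable, ?_⟩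
    rw [Measure.map_linearMap_addHaar_eq_smul_addHaar _ (by rw [hdet]; exact h.cross_ne_zero), hdet]
    rcases h.cross_eq with h | h <;> simp [h]
  have heq : chart v u w = (fun x => v + x) ∘ A ∘ WithLp.toLp 2 ∘ MeasurableEquiv.finTwoArrow.symm := by
    funext p
    simp only [chart, add_assoc]
    rfl
  rw [heq]
  exact (measurePreserving_add_left volume v).comp (hA.comp
    ((PiLp.volume_preserving_toLp (Fin 2)).comp (volume_preserving_finTwoArrow ℝ).symm))

lemma measurableEmbedding_chart {u w : Plane} (h : IsLatticeBasis u w) (v : Plane) :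
    MeasurableEmbedding (chart v u w) :=
  (continuous_chart v u w).measurableEmbedding (chart_injective h v)

end

/-! ### Riemann sums over a region that looks like a lattice quadrant -/

section

/-- The mixed term of order `q + 1` in the expansion over a quadrant with vertex `v`. -/
def cornerSum (f : Plane → ℝ) (v u w : Plane) (q : ℕ) : ℝ :=
  ∑ m ∈ Finset.range q, emCoeff (m + 1) * emCoeff (q - m) *
    (dirDeriv u)^[m] ((dirDeriv w)^[q - 1 - m] f) v

/-- The coefficients of the expansion of Riemann sums over `Δ`, when `Δ` coincides with the
quadrant at `v` spanned by `u` and `w` on the support of `f`. -/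
def quadrantCoeff (Δ : Set Plane) (f : Plane → ℝ) (v u w : Plane) : ℕ → ℝ
  | 0 => ∫ x in Δ, f x
  | q + 1 => emCoeff (q + 1) *
      (rayIntegral v u ((dirDeriv w)^[q] f) + rayIntegral v w ((dirDeriv u)^[q] f))
      + cornerSum f v u w q

/-- On the support of `f`, the set `Δ` coincides with the quadrant at `v` spanned by `u`, `w`. -/
def AgreesWithQuadrant (Δ : Set Plane) (f : Plane → ℝ) (v u w : Plane) : Prop :=
  ∀ s t : ℝ, v + s • u + t • w ∈ tsupport f → (v + s • u + t • w ∈ Δ ↔ 0 ≤ s ∧ 0 ≤ t)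

variable {Δ : Set Plane} {f : Plane → ℝ} {v u w : Plane}

/-- The coordinates are continuous, hence bounded on the support. Only upper bounds are needed,
since the quadrant itself bounds sums and integrals below. -/
lemma IsLatticeBasis.exists_coord_bound (h : IsLatticeBasis u w) (hf : HasCompactSupport f)
    (v : Plane) :
    ∃ R : ℕ, ∀ s t : ℝ, v + s • u + t • w ∈ tsupport f → s < R ∧ t < R := by
  have hc1 : Continuous fun x : Plane => cross u w * cross (x - v) w := by
    unfold cross; fun_prop
  have hc2 : Continuous fun x : Plane => cross u w * cross u (x - v) := by
    unfold cross; fun_prop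
  obtain ⟨B1, hB1⟩ := IsCompact.exists_bound_of_continuousOn hf hc1.continuousOn
  obtain ⟨B2, hB2⟩ := IsCompact.exists_bound_of_continuousOn hf hc2.continuousOn
  obtain ⟨R, hR⟩ := exists_nat_gt (max B1 B2)
  refine ⟨R, fun s t hst => ?_⟩
  have h1 := hB1 _ hst
  have h2 := hB2 _ hst
  have e : v + s • u + t • w - v = s • u + t • w := by abel
  rw [e, cross_add_smul_right, mul_left_comm, h.cross_mul_self, mul_one] at h1
  rw [e, cross_add_smul_left, mul_left_comm, h.cross_mul_self, mul_one] at h2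
  exact ⟨((le_abs_self s).trans h1).trans_lt ((le_max_left _ _).trans_lt hR),
    ((le_abs_self t).trans h2).trans_lt ((le_max_right _ _).trans_lt hR)⟩

lemma isDerivArray_chart (hf : IsTest f) {R : ℝ}
    (hR : ∀ s t : ℝ, v + s • u + t • w ∈ tsupport f → s < R ∧ t < R) :
    IsDerivArray R fun k l s t => (dirDeriv u)^[k] ((dirDeriv w)^[l] f) (v + s • u + t • w) := by
  have hsupp : ∀ k l x, x ∉ tsupport f → (dirDeriv u)^[k] ((dirDeriv w)^[l] f) x = 0 := by
    intro k l x hx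
    exact image_eq_zero_of_notMem_tsupport fun h =>
      hx (tsupport_dirDeriv_iterate_subset w f l (tsupport_dirDeriv_iterate_subset u _ k h))
  have htest : ∀ k l, IsTest ((dirDeriv u)^[k] ((dirDeriv w)^[l] f)) :=
    fun k l => (hf.iterate w l).iterate u k
  refine ⟨fun k l s t => ?_, fun k l s t => ?_, fun k l => ?_, fun k l => ?_, fun k l s t hs => ?_,
    fun k l s t ht => ?_⟩
  · have := hasDerivAt_line (htest k l).smooth (v + t • w) u s
    rw [← Function.iterate_succ_apply' (dirDeriv u)] at this
    simpa only [add_right_comm v (t • w)] using this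
  · have := hasDerivAt_line (htest k l).smooth (v + s • u) w t
    rwa [dirDeriv_iterate_comm (hf.iterate w l).smooth w u k,
      ← Function.iterate_succ_apply' (dirDeriv w)] at this
  · exact (htest k l).smooth.continuous.comp (by fun_prop)
  · obtain ⟨C, hC⟩ := (htest k l).compact.exists_bound_of_continuous (htest k l).smooth.continuous
    exact ⟨C, fun s t => hC _⟩
  · exact hsupp k l _ fun h => absurd (hR s t h).1 (not_lt.2 hs)
  · exact hsupp k l _ fun h => absurd (hR s t h).2 (not_lt.2 ht)

lemma integral_eq_rayIntegral {g : Plane → ℝ} {R : ℝ} (hR0 : 0 ≤ R)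
    (hR : ∀ t : ℝ, R ≤ t → g (v + t • w) = 0) :
    ∫ t in (0 : ℝ)..R, g (v + t • w) = rayIntegral v w g := by
  rw [intervalIntegral.integral_of_le hR0, rayIntegral]
  refine (setIntegral_eq_of_subset_of_forall_sdiff_eq_zero measurableSet_Ioi
    (fun t ht => ht.1) fun t ht => hR t ?_).symm
  by_contra h
  exact ht.2 ⟨ht.1, (not_le.1 h).le⟩

/-- Fubini and the unimodular change of variables. Passing from half-open to closed intervals
changes a null set only. -/
lemma AgreesWithQuadrant.integral_eq (h : AgreesWithQuadrant Δ f v u w) (hb : IsLatticeBasis u w)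
    (hΔ : MeasurableSet Δ) (hf : IsTest f) {R : ℝ} (hR0 : 0 ≤ R)
    (hR : ∀ s t : ℝ, v + s • u + t • w ∈ tsupport f → s < R ∧ t < R) :
    ∫ s in (0 : ℝ)..R, ∫ t in (0 : ℝ)..R, f (v + s • u + t • w) = ∫ x in Δ, f x := by
  have hcont : Continuous fun p => f (chart v u w p) :=
    hf.smooth.continuous.comp (continuous_chart v u w)
  have hmeas : MeasurableSet (chart v u w ⁻¹' Δ) := (continuous_chart v u w).measurable hΔ
  simp_rw [intervalIntegral.integral_of_le hR0]
  have h1 := setIntegral_prod (μ := volume) (ν := volume) (s := Set.Ioc 0 R) (t := Set.Ioc 0 R)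
    (fun p : ℝ × ℝ => f (chart v u w p))
    ((hcont.continuousOn.integrableOn_compact (isCompact_Icc.prod isCompact_Icc)).mono_set
      (Set.prod_mono Set.Ioc_subset_Icc_self Set.Ioc_subset_Icc_self))
  change ∫ s in Set.Ioc 0 R, ∫ t in Set.Ioc 0 R, f (chart v u w (s, t)) = _
  rw [← h1, ← (measurePreserving_chart hb v).setIntegral_preimage_emb
    (measurableEmbedding_chart hb v) f Δ,
    setIntegral_congr_set (Measure.set_prod_ae_eq Ioc_ae_eq_Icc Ioc_ae_eq_Icc),
    ← integral_indicator (measurableSet_Icc.prod measurableSet_Icc), ← integral_indicator hmeas]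
  congr 1
  ext ⟨s, t⟩
  by_cases hs : chart v u w (s, t) ∈ tsupport f
  · have e := h s t hs
    have hlt := hR s t hs
    have : (s, t) ∈ Set.Icc 0 R ×ˢ Set.Icc 0 R ↔ (s, t) ∈ chart v u w ⁻¹' Δ := by
      refine Iff.trans ?_ e.symm
      simp only [Set.mem_prod, Set.mem_Icc]
      exact ⟨fun h => ⟨h.1.1, h.2.1⟩, fun h => ⟨⟨h.1, hlt.1.le⟩, ⟨h.2, hlt.2.le⟩⟩⟩
    by_cases hm : (s, t) ∈ chart v u w ⁻¹' Δ
    · rw [Set.indicator_of_mem hm, Set.indicator_of_mem (this.2 hm)]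
    · rw [Set.indicator_of_notMem hm, Set.indicator_of_notMem (mt this.1 hm)]
  · have h0 : f (chart v u w (s, t)) = 0 := image_eq_zero_of_notMem_tsupport hs
    exact (Set.indicator_apply_eq_zero (f := fun p => f (chart v u w p)).2 fun _ => h0).trans
      (Set.indicator_apply_eq_zero (f := fun p => f (chart v u w p)).2 fun _ => h0).symm

/-- As `v` is a lattice point and `(u, w)` a lattice basis, the points of `NΔ` that `f` sees are `Nv
+ iu + jw` with natural `i`, `j`. The axes are included, the quadrant being closed. -/
lemma AgreesWithQuadrant.finsum_eq (h : AgreesWithQuadrant Δ f v u w) (hb : IsLatticeBasis u w)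
    (hv : v ∈ intPts) {R : ℕ}
    (hR : ∀ s t : ℝ, v + s • u + t • w ∈ tsupport f → s < R ∧ t < R) {N : ℕ} (hN : 0 < N) :
    ∑ᶠ k ∈ intPts ∩ (N : ℝ) • Δ, f ((N : ℝ)⁻¹ • k) =
      ∑ i ∈ Finset.range (R * N), ∑ j ∈ Finset.range (R * N),
        f (v + ((i : ℝ) / N) • u + ((j : ℝ) / N) • w) := by
  have hN' : (N : ℝ) ≠ 0 := by positivity
  have hNpos : (0 : ℝ) < N := by positivity
  set φ : ℕ × ℕ → Plane := fun p => (N : ℝ) • v + ((p.1 : ℝ) • u + (p.2 : ℝ) • w) with hφ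
  have hscale : ∀ p : ℕ × ℕ, (N : ℝ)⁻¹ • φ p = v + ((p.1 : ℝ) / N) • u + ((p.2 : ℝ) / N) • w := by
    intro p
    simp only [hφ, smul_add, smul_smul, inv_mul_cancel₀ hN', one_smul, add_assoc, div_eq_inv_mul]
  have hinj : Function.Injective φ := by
    rintro ⟨i, j⟩ ⟨i', j'⟩ he
    simp only [hφ, add_right_inj] at he
    obtain ⟨h1, h2⟩ := hb.combination_inj he
    exact Prod.ext (by exact_mod_cast h1) (by exact_mod_cast h2)
  have h1 : ∑ᶠ k ∈ φ '' (Finset.range (R * N) ×ˢ Finset.range (R * N) : Finset (ℕ × ℕ)),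
      f ((N : ℝ)⁻¹ • k) = ∑ i ∈ Finset.range (R * N), ∑ j ∈ Finset.range (R * N),
        f (v + ((i : ℝ) / N) • u + ((j : ℝ) / N) • w) := by
    rw [finsum_mem_image hinj.injOn, finsum_mem_coe_finset, Finset.sum_product]
    simp only [hscale]
  rw [← h1]
  refine finsum_mem_inter_support_eq' _ _ _ fun k hk => ?_
  have hk' : (N : ℝ)⁻¹ • k ∈ tsupport f := subset_tsupport f hk
  have hΔ : k ∈ (N : ℝ) • Δ ↔ (N : ℝ)⁻¹ • k ∈ Δ := Set.mem_smul_set_iff_inv_smul_mem₀ hN' _ _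
  constructor
  · rintro ⟨hkI, hkΔ⟩
    obtain ⟨⟨i, j⟩, hij, -⟩ := hb.2.2 (k - (N : ℝ) • v)
      (intPts_sub hkI (by exact_mod_cast intPts_smul hv N))
    have hk1 : k = (N : ℝ) • v + ((i : ℝ) • u + (j : ℝ) • w) := by
      rw [← hij]; abel
    have hk2 : (N : ℝ)⁻¹ • k = v + ((i : ℝ) / N) • u + ((j : ℝ) / N) • w := by
      rw [hk1]
      simp only [smul_add, smul_smul, inv_mul_cancel₀ hN', one_smul, add_assoc, div_eq_inv_mul]
    rw [hΔ] at hkΔ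
    rw [hk2] at hk' hkΔ
    obtain ⟨hi, hj⟩ := (h _ _ hk').1 hkΔ
    obtain ⟨hi', hj'⟩ := hR _ _ hk'
    rw [div_lt_iff₀ hNpos] at hi' hj'
    rw [le_div_iff₀ hNpos, zero_mul] at hi hj
    have hi0 : 0 ≤ i := by exact_mod_cast hi
    have hj0 : 0 ≤ j := by exact_mod_cast hj
    lift i to ℕ using hi0
    lift j to ℕ using hj0
    refine ⟨(i, j), ?_, ?_⟩
    · simp only [Finset.coe_product, Set.mem_prod, Finset.coe_range, Set.mem_Iio]
      exact ⟨by exact_mod_cast hi', by exact_mod_cast hj'⟩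
    · simp [hφ, hk1]
  · rintro ⟨⟨i, j⟩, -, rfl⟩
    refine ⟨?_, hΔ.2 ?_⟩
    · refine intPts_add (by exact_mod_cast intPts_smul hv N) (intPts_add ?_ ?_)
      · exact_mod_cast intPts_smul hb.1 i
      · exact_mod_cast intPts_smul hb.2.1 j
    · rw [hscale] at hk' ⊢
      exact (h _ _ hk').2 ⟨by positivity, by positivity⟩

lemma HasExpansion.congr {S S' T T' : ℕ → ℝ} (h : HasExpansion S T)
    (hS : ∀ N, 0 < N → S' N = S N) (hT : ∀ q, T' q = T q) : HasExpansion S' T' := by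
  intro Q
  refine (h Q).congr' ?_ EventuallyEq.rfl
  filter_upwards [eventually_gt_atTop 0] with N hN
  simp [hS N hN, hT]

/-- The expansion of Riemann sums over `Δ` when `Δ` coincides with a quadrant on the support of the
function. -/
theorem AgreesWithQuadrant.hasExpansion (h : AgreesWithQuadrant Δ f v u w)
    (hb : IsLatticeBasis u w) (hv : v ∈ intPts) (hΔ : MeasurableSet Δ) (hf : IsTest f) :
    HasExpansion (riemannSum Δ f) (quadrantCoeff Δ f v u w) := by
  obtain ⟨R, hR⟩ := hb.exists_coord_bound hf.compact v
  have hF := isDerivArray_chart hf hR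
  refine hF.hasExpansion.congr (fun N hN => ?_) fun q => ?_
  · rw [riemannSum, h.finsum_eq hb hv hR hN]
    rfl
  · have hR0 : (0 : ℝ) ≤ R := R.cast_nonneg
    rcases q with _ | q
    · simpa [quadrantCoeff, quadrantFunctional, emFunctional, emCoeff] using
        (h.integral_eq hb hΔ hf hR0 hR).symm
    -- The two extreme terms of the antidiagonal, of index `0` in one variable, are the ray
    -- integrals; the others form `cornerSum`.
    · rw [Finset.Nat.sum_antidiagonal_eq_sum_range_succ_mk, Finset.sum_range_succ,
        Finset.sum_range_succ']
      have e0 : emCoeff 0 = 1 := by simp [emCoeff]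
      have h1 : quadrantFunctional R (fun k l s t =>
          (dirDeriv u)^[k] ((dirDeriv w)^[l] f) (v + s • u + t • w)) 0 (q + 1)
          = rayIntegral v u ((dirDeriv w)^[q] f) := by
        rw [← integral_eq_rayIntegral hR0]
        · simp [quadrantFunctional, emFunctional]
        · intro s hs
          simpa using hF.vanish_fst 0 q s 0 hs
      have h2 : quadrantFunctional R (fun k l s t =>
          (dirDeriv u)^[k] ((dirDeriv w)^[l] f) (v + s • u + t • w)) (q + 1) 0
          = rayIntegral v w ((dirDeriv u)^[q] f) := by
        rw [← integral_eq_rayIntegral hR0]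
        · simp [quadrantFunctional, emFunctional]
        · intro t ht
          simpa using hF.vanish_snd q 0 0 t ht
      simp only [Nat.sub_self, Nat.sub_zero, e0, h1, h2, quadrantCoeff, cornerSum]
      have h3 : ∀ m ∈ Finset.range q, emCoeff (m + 1) * emCoeff (q + 1 - (m + 1)) *
          quadrantFunctional R (fun k l s t =>
            (dirDeriv u)^[k] ((dirDeriv w)^[l] f) (v + s • u + t • w)) (m + 1) (q + 1 - (m + 1))
          = emCoeff (m + 1) * emCoeff (q - m) *
            (dirDeriv u)^[m] ((dirDeriv w)^[q - 1 - m] f) v := by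
        intro m hm
        rw [Finset.mem_range] at hm
        have e1 : q + 1 - (m + 1) = (q - 1 - m) + 1 := by omega
        have e2 : q - m = (q - 1 - m) + 1 := by omega
        rw [e1, e2]
        simp [quadrantFunctional, emFunctional]
      rw [Finset.sum_congr rfl h3]
      ring

end

/-! ### The normalised edge integral as a parameter integral -/

section

variable {e : Set Plane} {a p v w : Plane} {f g : Plane → ℝ}

/-- The unit-speed parametrisation is an isometry and carries Lebesgue measure to one-dimensional
Hausdorff measure; rescaling to speed `‖a‖` cancels the normalising factor. -/
lemma starIntegral_eq (ha : a ≠ 0) (he : MeasurableSet e)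
    (hline : ∀ x ∈ e, ∃ t : ℝ, x = p + t • a) (g : Plane → ℝ) :
    starIntegral a e g = ∫ t in ((fun t : ℝ => p + t • a) ⁻¹' e), g (p + t • a) := by
  have hna : ‖a‖ ≠ 0 := norm_ne_zero_iff.2 ha
  set γ : ℝ → Plane := fun t => p + t • (‖a‖⁻¹ • a) with hγ
  have hiso : Isometry γ := by
    refine Isometry.of_dist_eq fun s t => ?_
    rw [hγ, dist_add_left, dist_eq_norm, ← sub_smul, norm_smul, norm_smul, norm_inv, norm_norm,
      inv_mul_cancel₀ hna, mul_one, Real.dist_eq, Real.norm_eq_abs]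
  have hrange : e ⊆ Set.range γ := by
    intro x hx
    obtain ⟨t, rfl⟩ := hline x hx
    exact ⟨t * ‖a‖, by simp [hγ, smul_smul, hna]⟩
  have hmap : Measure.map γ volume = (μH[1] : Measure Plane).restrict (Set.range γ) := by
    rw [← hausdorffMeasure_real]
    exact hiso.map_hausdorffMeasure (Or.inl zero_le_one)
  have hemb : MeasurableEmbedding γ := hiso.continuous.measurableEmbedding hiso.injective
  have h1 : ∫ x in e, g x ∂(μH[1] : Measure Plane) = ∫ t in γ ⁻¹' e, g (γ t) := by
    rw [← hemb.setIntegral_map, hmap, Measure.restrict_restrict_of_subset hrange]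
  have hmeas : MeasurableSet ((fun t : ℝ => p + t • a) ⁻¹' e) :=
    (by fun_prop : Continuous fun t : ℝ => p + t • a).measurable he
  rw [starIntegral, h1, ← integral_indicator (hiso.continuous.measurable he),
    ← integral_indicator hmeas]
  have h2 := Measure.integral_comp_mul_left ((γ ⁻¹' e).indicator fun t => g (γ t)) ‖a‖
  rw [smul_eq_mul, abs_of_nonneg (by positivity)] at h2
  rw [← h2]
  congr 1
  ext t
  have : γ (‖a‖ * t) = p + t • a := by
    rw [hγ]
    simp only [smul_smul]
    rw [mul_right_comm, mul_inv_cancel₀ hna, one_mul]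
  by_cases ht : t ∈ (fun t : ℝ => p + t • a) ⁻¹' e
  · rw [Set.indicator_of_mem (by simpa [this] using ht), this,
      Set.indicator_of_mem ht]
  · rw [Set.indicator_of_notMem (by simpa [this] using ht),
      Set.indicator_of_notMem ht]

lemma starIntegral_congr_norm (h : ‖a‖ = ‖w‖) : starIntegral a e g = starIntegral w e g := by
  rw [starIntegral, starIntegral, h]

lemma starIntegral_add (ha : a ≠ 0) (he : MeasurableSet e)
    (hline : ∀ x ∈ e, ∃ t : ℝ, x = p + t • a) (hf : IsTest f) (hg : IsTest g) :
    starIntegral a e (f + g) = starIntegral a e f + starIntegral a e g := by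
  rw [starIntegral_eq ha he hline, starIntegral_eq ha he hline, starIntegral_eq ha he hline]
  exact integral_add (integrable_line hf.smooth.continuous hf.compact ha p).integrableOn
    (integrable_line hg.smooth.continuous hg.compact ha p).integrableOn

lemma starIntegral_const_mul (c : ℝ) : starIntegral a e (fun x => c * f x) = c * starIntegral a e f := by
  rw [starIntegral, starIntegral, integral_const_mul]
  ring

lemma starIntegral_eq_zero (h : ∀ x ∈ e, g x = 0) (he : MeasurableSet e) :
    starIntegral a e g = 0 := by
  rw [starIntegral, setIntegral_congr_fun he h]
  simp

/-- Agreement of edge and ray is asked only where `g` is nonzero, because the edge stops at its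
other end. -/
lemma starIntegral_eq_rayIntegral (ha : a ≠ 0) (he : MeasurableSet e)
    (hline : ∀ x ∈ e, ∃ t : ℝ, x = v + t • a)
    (hg : ∀ t : ℝ, g (v + t • a) ≠ 0 → (v + t • a ∈ e ↔ 0 ≤ t)) :
    starIntegral a e g = rayIntegral v a g := by
  rw [starIntegral_eq ha he hline, rayIntegral, setIntegral_congr_set Ioi_ae_eq_Ici,
    ← integral_indicator, ← integral_indicator measurableSet_Ici]
  · congr 1
    ext t
    by_cases h0 : g (v + t • a) = 0
    · exact (Set.indicator_apply_eq_zero (f := fun t : ℝ => g (v + t • a)).2 fun _ => h0).trans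
        (Set.indicator_apply_eq_zero (f := fun t : ℝ => g (v + t • a)).2 fun _ => h0).symm
    · have : t ∈ (fun t : ℝ => v + t • a) ⁻¹' e ↔ 0 ≤ t := hg t h0
      by_cases ht : 0 ≤ t
      · rw [Set.indicator_of_mem (Set.mem_Ici.2 ht), Set.indicator_of_mem (this.2 ht)]
      · rw [Set.indicator_of_notMem (mt Set.mem_Ici.1 ht),
          Set.indicator_of_notMem (mt this.1 ht)]
  · exact (by fun_prop : Continuous fun t : ℝ => v + t • a).measurable he

end

/-! ### Convex geometry of the polygon at edges, vertices and boundary points -/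

section

variable {Δ e : Set Plane} {a b v w₁ w₂ : Plane}

namespace IsDelzantLatticePolygon

lemma isCompact (hΔ : IsDelzantLatticePolygon Δ) : IsCompact Δ := by
  obtain ⟨S, hS, -, rfl⟩ := hΔ.exists_hull
  exact hS.isCompact_convexHull ℝ

lemma convex (hΔ : IsDelzantLatticePolygon Δ) : Convex ℝ Δ := by
  obtain ⟨S, -, -, rfl⟩ := hΔ.exists_hull
  exact convex_convexHull ℝ S

lemma nonempty (hΔ : IsDelzantLatticePolygon Δ) : Δ.Nonempty :=
  hΔ.interior_nonempty.mono interior_subset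

lemma vertices_finite (hΔ : IsDelzantLatticePolygon Δ) : (vertices Δ).Finite := by
  obtain ⟨S, hS, -, rfl⟩ := hΔ.exists_hull
  exact hS.subset extremePoints_convexHull_subset

lemma vertices_subset (hΔ : IsDelzantLatticePolygon Δ) : vertices Δ ⊆ intPts := by
  obtain ⟨S, -, hS, rfl⟩ := hΔ.exists_hull
  exact extremePoints_convexHull_subset.trans hS

end IsDelzantLatticePolygon

namespace IsEdge

lemma nonempty (he : IsEdge Δ e) : e.Nonempty := by
  rw [Set.nonempty_iff_ne_empty]
  rintro rfl
  have h := he.2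
  rw [vectorSpan_of_subsingleton ℝ Set.subsingleton_empty] at h
  simp at h

lemma subset (he : IsEdge Δ e) : e ⊆ Δ := he.1.subset

lemma isCompact (he : IsEdge Δ e) (hΔ : IsDelzantLatticePolygon Δ) : IsCompact e :=
  he.1.isCompact hΔ.isCompact

lemma measurableSet (he : IsEdge Δ e) (hΔ : IsDelzantLatticePolygon Δ) : MeasurableSet e :=
  (he.isCompact hΔ).isClosed.measurableSet

lemma exists_vertex (he : IsEdge Δ e) (hΔ : IsDelzantLatticePolygon Δ) : ∃ v ∈ vertices Δ, v ∈ e := by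
  obtain ⟨v, hv⟩ := (he.isCompact hΔ).extremePoints_nonempty he.nonempty
  exact ⟨v, he.1.isExtreme.extremePoints_subset_extremePoints hv, hv.1⟩

/-- The exposing functional cannot vanish: otherwise `e` would be all of `Δ`, which spans two
dimensions. -/
lemma exists_functional (he : IsEdge Δ e) (hΔ : IsDelzantLatticePolygon Δ) :
    ∃ l : StrongDual ℝ Plane, l ≠ 0 ∧ (∀ x ∈ e, ∀ y ∈ Δ, l y ≤ l x) ∧
      ∀ x ∈ e, ∀ y ∈ Δ, l y = l x → y ∈ e := by
  obtain ⟨l, hl⟩ := he.1 he.nonempty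
  refine ⟨l, ?_, fun x hx y hy => (hl ▸ hx).2 y hy, fun x hx y hy hxy => ?_⟩
  · rintro rfl
    have : e = Δ := by rw [hl]; ext; simp
    have htop : vectorSpan ℝ Δ = ⊤ :=
      AffineSubspace.vectorSpan_eq_top_of_affineSpan_eq_top ℝ Plane Plane
        (hΔ.convex.interior_nonempty_iff_affineSpan_eq_top.1 hΔ.interior_nonempty)
    have h2 := he.2
    rw [this, htop] at h2
    simp at h2
  · rw [hl]
    exact ⟨hy, fun z hz => hxy ▸ (hl ▸ hx).2 z hz⟩

lemma functional_eq_zero {l : StrongDual ℝ Plane} (hl : ∀ x ∈ e, ∀ y ∈ e, l y ≤ l x)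
    (ha : a ∈ vectorSpan ℝ e) : l a = 0 := by
  have : vectorSpan ℝ e ≤ l.toLinearMap.ker := by
    rw [vectorSpan_def, Submodule.span_le]
    rintro _ ⟨x, hx, y, hy, rfl⟩
    have := le_antisymm (hl x hx y hy) (hl y hy x hx)
    simp [this]
  exact this ha

lemma exists_eq_add_smul (he : IsEdge Δ e) (ha : a ∈ vectorSpan ℝ e) (ha0 : a ≠ 0) {p x : Plane}
    (hp : p ∈ e) (hx : x ∈ e) : ∃ t : ℝ, x = p + t • a := by
  obtain ⟨c, hc⟩ := (finrank_eq_one_iff_of_nonzero' (⟨a, ha⟩ : vectorSpan ℝ e)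
    (by simpa using ha0)).1 he.2 ⟨x - p, vsub_mem_vectorSpan ℝ hx hp⟩
  refine ⟨c, ?_⟩
  have := congrArg Subtype.val hc
  simp only [Submodule.coe_smul] at this
  rw [this]
  abel

lemma functional_neg {l : StrongDual ℝ Plane} (h0 : l ≠ 0)
    (hb : IsLatticeBasis a b) (hla : l a = 0) (hlb : l b ≤ 0) : l b < 0 := by
  refine hlb.lt_of_ne fun h => h0 ?_
  ext x
  rw [hb.eq_combination x]
  simp [hla, h]

end IsEdge

/-- By Krein–Milman an edge is determined by its extreme points, which are among the finitely many
vertices. -/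
lemma edges_finite (hΔ : IsDelzantLatticePolygon Δ) : (edges Δ).Finite := by
  refine (hΔ.vertices_finite.powerset.image fun s => closure (convexHull ℝ s)).subset ?_
  intro e he
  have he : IsEdge Δ e := he
  exact ⟨e.extremePoints ℝ, he.1.isExtreme.extremePoints_subset_extremePoints,
    closure_convexHull_extremePoints (he.isCompact hΔ) (he.1.convex hΔ.convex)⟩

/-- The half-plane `l ≤ 0` is a convex cone containing all directions from `e` into `Δ`, hence `b`;
equality at `b` would make `l` vanish on a basis. -/
lemma IsEdgeBasis.functional (h : IsEdgeBasis Δ e a b) (he : IsEdge Δ e) {l : StrongDual ℝ Plane}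
    (h0 : l ≠ 0) (hmax : ∀ x ∈ e, ∀ y ∈ Δ, l y ≤ l x) : l a = 0 ∧ l b < 0 := by
  have hla : l a = 0 := IsEdge.functional_eq_zero (fun x hx y hy => hmax x hx y (he.subset hy)) h.2.1
  have hle : coneAt Δ e ≤ (ConvexCone.mk {z | l z ≤ 0}
      (fun c hc x (hx : l x ≤ 0) => by simpa using mul_nonpos_of_nonneg_of_nonpos hc.le hx)
      (fun x (hx : l x ≤ 0) y (hy : l y ≤ 0) => by simpa using add_nonpos hx hy) :
        ConvexCone ℝ Plane) := by
    refine ConvexCone.hull_min ?_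
    rintro _ ⟨x, hx, y, hy, rfl⟩
    simpa using hmax x hx y hy
  exact ⟨hla, IsEdge.functional_neg h0 h.1 hla (hle h.2.2)⟩

/-- In the coordinates given by an edge basis, `Δ` lies in the upper half-plane and the edge is its
intersection with the boundary line. -/
lemma IsEdgeBasis.coord (h : IsEdgeBasis Δ e a b) (hΔ : IsDelzantLatticePolygon Δ) (he : IsEdge Δ e)
    {p : Plane} (hp : p ∈ e) {s t : ℝ} (hx : p + s • a + t • b ∈ Δ) :
    0 ≤ t ∧ (p + s • a + t • b ∈ e ↔ t = 0) := by
  obtain ⟨l, h0, hmax, hface⟩ := he.exists_functional hΔ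
  obtain ⟨hla, hlb⟩ := h.functional he h0 hmax
  have hval : l (p + s • a + t • b) = l p + t * l b := by simp [hla]
  have h1 := hmax p hp _ hx
  rw [hval] at h1
  refine ⟨by nlinarith, fun hmem => ?_, fun ht => hface p hp _ hx (by rw [hval, ht]; simp)⟩
  have h2 := hmax _ hmem p (he.subset hp)
  rw [hval] at h2
  nlinarith

lemma exists_pos_of_edgeAlong {w : Plane} (he : IsEdge Δ (edgeAlong Δ v w)) :
    ∃ t : ℝ, 0 < t ∧ v + t • w ∈ Δ := by
  by_contra! h
  have : (edgeAlong Δ v w).Subsingleton := by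
    have h1 : ∀ x ∈ edgeAlong Δ v w, x = v := by
      rintro x ⟨hx, t, ht, rfl⟩
      rcases ht.eq_or_lt with rfl | ht
      · simp
      · exact absurd hx (h t ht)
    intro x hx y hy
    rw [h1 x hx, h1 y hy]
  have h2 := he.2
  rw [vectorSpan_of_subsingleton ℝ this] at h2
  simp at h2

lemma mem_edgeAlong_self {w : Plane} (hv : v ∈ Δ) : v ∈ edgeAlong Δ v w := ⟨hv, 0, le_rfl, by simp⟩

lemma mem_vectorSpan_edgeAlong {w : Plane} (hv : v ∈ Δ) (he : IsEdge Δ (edgeAlong Δ v w)) :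
    w ∈ vectorSpan ℝ (edgeAlong Δ v w) := by
  obtain ⟨t, ht, htΔ⟩ := exists_pos_of_edgeAlong he
  have := vsub_mem_vectorSpan ℝ (show v + t • w ∈ edgeAlong Δ v w from ⟨htΔ, t, ht.le, rfl⟩)
    (mem_edgeAlong_self hv)
  have h2 := Submodule.smul_mem _ t⁻¹ this
  simpa [smul_smul, ht.ne'] using h2

lemma edgeAlong_isEdgeBasis (hv : v ∈ Δ) (hb : IsLatticeBasis w₁ w₂)
    (he₁ : IsEdge Δ (edgeAlong Δ v w₁)) (he₂ : IsEdge Δ (edgeAlong Δ v w₂)) :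
    IsEdgeBasis Δ (edgeAlong Δ v w₁) w₁ w₂ := by
  obtain ⟨t, ht, htΔ⟩ := exists_pos_of_edgeAlong he₂
  refine ⟨hb, mem_vectorSpan_edgeAlong hv he₁, ?_⟩
  have h1 : t • w₂ ∈ coneAt Δ (edgeAlong Δ v w₁) :=
    ConvexCone.subset_hull ⟨v, mem_edgeAlong_self hv, _, htΔ, by abel⟩
  simpa [smul_smul, ht.ne'] using (coneAt Δ (edgeAlong Δ v w₁)).smul_mem (inv_pos.2 ht) h1

lemma IsLatticeBasis.symm (hb : IsLatticeBasis w₁ w₂) : IsLatticeBasis w₂ w₁ := by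
  refine ⟨hb.2.1, hb.1, fun x hx => ?_⟩
  obtain ⟨k, hk, huniq⟩ := hb.2.2 x hx
  refine ⟨k.swap, by simp only [Prod.fst_swap, Prod.snd_swap]; rw [add_comm]; exact hk, fun l hl => ?_⟩
  have := huniq l.swap (by simp only [Prod.fst_swap, Prod.snd_swap]; rw [add_comm]; exact hl)
  rw [← this, Prod.swap_swap]

lemma IsVertexBasis.symm (h : IsVertexBasis Δ v w₁ w₂) : IsVertexBasis Δ v w₂ w₁ :=
  ⟨h.1.symm, h.2.2.1, h.2.1, fun e he hve => (h.2.2.2 e he hve).symm⟩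

namespace IsVertexBasis

lemma isEdgeBasis (h : IsVertexBasis Δ v w₁ w₂) (hv : v ∈ Δ) :
    IsEdgeBasis Δ (edgeAlong Δ v w₁) w₁ w₂ :=
  edgeAlong_isEdgeBasis hv h.1 h.2.1 h.2.2.1

lemma snd_nonneg (h : IsVertexBasis Δ v w₁ w₂) (hΔ : IsDelzantLatticePolygon Δ) (hv : v ∈ Δ)
    {s t : ℝ} (hx : v + s • w₁ + t • w₂ ∈ Δ) : 0 ≤ t :=
  ((h.isEdgeBasis hv).coord hΔ h.2.1 (mem_edgeAlong_self hv) hx).1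

lemma fst_nonneg (h : IsVertexBasis Δ v w₁ w₂) (hΔ : IsDelzantLatticePolygon Δ) (hv : v ∈ Δ)
    {s t : ℝ} (hx : v + s • w₁ + t • w₂ ∈ Δ) : 0 ≤ s :=
  h.symm.snd_nonneg hΔ hv (s := t) (by rwa [add_right_comm])

lemma edgeAlong_ne (h : IsVertexBasis Δ v w₁ w₂) :
    edgeAlong Δ v w₁ ≠ edgeAlong Δ v w₂ := by
  intro heq
  obtain ⟨t, ht, htΔ⟩ := exists_pos_of_edgeAlong h.2.1
  have hmem : v + t • w₁ ∈ edgeAlong Δ v w₂ := heq ▸ ⟨htΔ, t, ht.le, rfl⟩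
  obtain ⟨-, s, -, hs⟩ := hmem
  have := h.1.combination_inj (s := t) (t := 0) (s' := 0) (t' := s) (by simpa using hs)
  exact ht.ne' this.1

lemma exists_triangle (h : IsVertexBasis Δ v w₁ w₂) (hΔ : IsDelzantLatticePolygon Δ) (hv : v ∈ Δ) :
    ∃ ε > 0, ∀ s t : ℝ, 0 ≤ s → s < ε → 0 ≤ t → t < ε → v + s • w₁ + t • w₂ ∈ Δ := by
  obtain ⟨t₁, ht₁, h₁⟩ := exists_pos_of_edgeAlong h.2.1
  obtain ⟨t₂, ht₂, h₂⟩ := exists_pos_of_edgeAlong h.2.2.1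
  -- The halves keep the weights `s / t₁` and `t / t₂` of the two edge points at total at most `1`.
  refine ⟨min (t₁ / 2) (t₂ / 2), by positivity, fun s t hs hs' ht ht' => ?_⟩
  have hs1 : s / t₁ ≤ 1 / 2 := by
    rw [div_le_iff₀ ht₁]; linarith [min_le_left (t₁ / 2) (t₂ / 2)]
  have ht1 : t / t₂ ≤ 1 / 2 := by
    rw [div_le_iff₀ ht₂]; linarith [min_le_right (t₁ / 2) (t₂ / 2)]
  have hmem := hΔ.convex.sum_mem (t := Finset.univ) (w := ![1 - s / t₁ - t / t₂, s / t₁, t / t₂])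
    (z := ![v, v + t₁ • w₁, v + t₂ • w₂])
    (by
      intro i _
      fin_cases i
      · change 0 ≤ 1 - s / t₁ - t / t₂
        linarith
      · change 0 ≤ s / t₁
        positivity
      · change 0 ≤ t / t₂
        positivity)
    (by simp [Fin.sum_univ_three]; ring)
    (by intro i _; fin_cases i <;> assumption)
  convert hmem using 1
  simp only [Fin.sum_univ_three, Matrix.cons_val, smul_add, smul_smul, div_mul_cancel₀ _ ht₁.ne',
    div_mul_cancel₀ _ ht₂.ne']
  module

end IsVertexBasis

/-- Near a boundary point that is no vertex, `Δ` is a half-plane bounded by its only edge through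
that point. -/
lemma exists_edge_of_not_vertex (hΔ : IsDelzantLatticePolygon Δ) {x : Plane} (hx : x ∈ Δ)
    (hint : x ∉ interior Δ) (hvert : x ∉ vertices Δ) :
    ∃ e, IsEdge Δ e ∧ x ∈ e ∧ ∀ a b, IsEdgeBasis Δ e a b →
      (∃ ε > 0, ∀ s t : ℝ, |s| < ε → 0 ≤ t → t < ε → x + s • a + t • b ∈ Δ) ∧
      ∀ e', IsEdge Δ e' → x ∈ e' → e' = e := by
  -- The edge is the face cut out by a supporting line at `x`.
  obtain ⟨l, hl⟩ := geometric_hahn_banach_open_point hΔ.convex.interior isOpen_interior hint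
  obtain ⟨p₀, hp₀⟩ := hΔ.interior_nonempty
  have hlle : ∀ y ∈ Δ, l y ≤ l x := by
    intro y hy
    have h1 : y ∈ closure (interior Δ) := by
      rw [hΔ.convex.closure_interior_eq_closure_of_nonempty_interior hΔ.interior_nonempty]
      exact subset_closure hy
    exact closure_minimal (t := {y | l y ≤ l x}) (fun z hz => (hl z hz).le)
      (isClosed_le l.continuous continuous_const) h1
  set e : Set Plane := {z ∈ Δ | ∀ y ∈ Δ, l y ≤ l z} with he_def
  have hexp : IsExposed ℝ Δ e := fun _ => ⟨l, rfl⟩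
  have hxe : x ∈ e := ⟨hx, hlle⟩
  have hl0 : l ≠ 0 := by
    rintro rfl
    simpa using hl p₀ hp₀
  have hp₀e : p₀ ∉ e := fun h => absurd (h.2 x hx) (not_le.2 (hl p₀ hp₀))
  have hext : x ∉ e.extremePoints ℝ := fun h =>
    hvert (hexp.isExtreme.extremePoints_subset_extremePoints h)
  -- The face lies in a line because `l ≠ 0`, and it is not a single point because `x` is not
  -- extreme.
  have hedge : IsEdge Δ e := by
    refine ⟨hexp, le_antisymm ?_ ?_⟩
    · have hker : vectorSpan ℝ e ≤ l.toLinearMap.ker := fun a ha =>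
        IsEdge.functional_eq_zero (fun x hx y hy => hx.2 y hy.1) ha
      have hlt : l.toLinearMap.ker < ⊤ := lt_top_iff_ne_top.2 fun h => hl0 (by
        ext y
        exact (h ▸ Submodule.mem_top : y ∈ l.toLinearMap.ker))
      have := Submodule.finrank_lt (hker.trans_lt hlt).ne
      simp at this
      omega
    · rw [Nat.one_le_iff_ne_zero]
      intro h
      rw [Submodule.finrank_eq_zero, vectorSpan_eq_bot_iff_subsingleton] at h
      refine hext ⟨hxe, fun y hy z hz _ => h hy hxe⟩
  refine ⟨e, hedge, hxe, fun a b hab => ?_⟩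
  have ha0 := hab.1.fst_ne_zero
  obtain ⟨α, β, hα, hβ, hyΔ, hzΔ⟩ : ∃ α β : ℝ, α < 0 ∧ 0 < β ∧ x + α • a ∈ Δ ∧ x + β • a ∈ Δ := by
    simp only [mem_extremePoints_iff_left, not_and, not_forall] at hext
    obtain ⟨y, hy, z, hz, ⟨θ, θ', hθ, hθ', hθs, hθx⟩, hyx⟩ := hext hxe
    obtain ⟨α, rfl⟩ := hedge.exists_eq_add_smul hab.2.1 ha0 hxe hy
    obtain ⟨β, rfl⟩ := hedge.exists_eq_add_smul hab.2.1 ha0 hxe hz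
    have hα0 : α ≠ 0 := by rintro rfl; simp at hyx
    have hrel : θ * α + θ' * β = 0 := by
      have h1 : (θ * α + θ' * β) • a = 0 := by
        have h2 : (θ + θ') • x + (θ * α + θ' * β) • a = x :=
          Eq.trans (by module) hθx
        rw [hθs, one_smul] at h2
        simpa using h2
      exact (smul_eq_zero.1 h1).resolve_right ha0
    rcases hα0.lt_or_gt with h | h
    · exact ⟨α, β, h, by nlinarith, hy.1, hz.1⟩
    · exact ⟨β, α, by nlinarith, h, hz.1, hy.1⟩
  set δ := min (-α) β with hδ_def
  have hδ : 0 < δ := lt_min (by linarith) hβ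
  have hseg : ∀ s : ℝ, |s| ≤ δ → x + s • a ∈ Δ := by
    intro s hs
    have hconv : Convex ℝ ((fun s : ℝ => x + s • a) ⁻¹' Δ) := by
      intro s hs t ht p q hp hq hpq
      have := hΔ.convex hs ht hp hq hpq
      have he : p • (x + s • a) + q • (x + t • a) = (p + q) • x + (p • s + q • t) • a := by module
      rwa [he, hpq, one_smul] at this
    exact hconv.ordConnected.out hyΔ hzΔ
      ⟨by linarith [(abs_le.1 hs).1, min_le_left (-α) β], by linarith [(abs_le.1 hs).2, min_le_right (-α) β]⟩
  -- A nearby point above the edge is `(1 - lam)` times a point of the edge segment around `x` plus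
  -- `lam` times the interior point `p₀`, with `lam = t / t₀`. The choice of `ε` gives `lam ≤ 1/2`
  -- and keeps the segment point within `δ` of `x` in the coordinate along `a`.
  have hhalf : ∃ ε > 0, ∀ s t : ℝ, |s| < ε → 0 ≤ t → t < ε → x + s • a + t • b ∈ Δ := by
    set s₀ := cross a b * cross (p₀ - x) b
    set t₀ := cross a b * cross a (p₀ - x)
    have hp : p₀ = x + s₀ • a + t₀ • b := by
      rw [add_assoc, ← hab.1.eq_combination (p₀ - x)]; abel
    have hp₀Δ : x + s₀ • a + t₀ • b ∈ Δ := hp ▸ interior_subset hp₀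
    have hc := hab.coord hΔ hedge hxe hp₀Δ
    have ht₀ : 0 < t₀ := hc.1.lt_of_ne fun h => hp₀e (by rw [hp]; exact hc.2.2 h.symm)
    set K := |s₀| / t₀ with hK_def
    have hK : 0 ≤ K := by positivity
    refine ⟨min (t₀ / 2) (δ / (2 * (1 + K))), by positivity, fun s t hs ht ht' => ?_⟩
    have hlam : t / t₀ ≤ 1 / 2 := by
      rw [div_le_iff₀ ht₀]; linarith [min_le_left (t₀ / 2) (δ / (2 * (1 + K)))]
    set lam := t / t₀ with hlam_def
    have hlam0 : 0 ≤ lam := by positivity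
    have h1 : 0 < 1 - lam := by linarith
    have hbound : |s - lam * s₀| ≤ δ * (1 - lam) := by
      have h2 : min (t₀ / 2) (δ / (2 * (1 + K))) * (1 + K) ≤ δ / 2 := by
        calc _ ≤ δ / (2 * (1 + K)) * (1 + K) := by gcongr; exact min_le_right _ _
          _ = δ / 2 := by field_simp
      have h3 : lam * |s₀| = t * K := by rw [hlam_def, hK_def]; ring
      have h4 : |s - lam * s₀| ≤ |s| + t * K := by
        rw [← h3]
        calc _ ≤ |s| + |lam * s₀| := abs_sub _ _
          _ = _ := by rw [abs_mul, abs_of_nonneg hlam0]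
      have h5 : t * K ≤ min (t₀ / 2) (δ / (2 * (1 + K))) * K := by gcongr
      nlinarith
    have hmem := hΔ.convex (hseg ((s - lam * s₀) / (1 - lam)) (by
      rw [abs_div, abs_of_pos h1, div_le_iff₀ h1]; exact hbound)) hp₀Δ h1.le hlam0 (by ring)
    convert hmem using 1
    have e1 : t = lam * t₀ := by rw [hlam_def]; field_simp
    have e2 : (1 - lam) * ((s - lam * s₀) / (1 - lam)) = s - lam * s₀ := by field_simp
    rw [smul_add, smul_smul, e2, e1]
    module
  -- A functional exposing another edge through `x` vanishes on `a`, as `x` is inside a segment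
  -- along `a`, and is negative on `b`; so it cuts out the same face.
  refine ⟨hhalf, fun e' he' hxe' => ?_⟩
  obtain ⟨l', hl'0, hmax, hface⟩ := he'.exists_functional hΔ
  obtain ⟨ε, hε, hε'⟩ := hhalf
  have hla : l' a = 0 := by
    have h1 := hmax x hxe' _ (hseg δ (by rw [abs_of_pos hδ]))
    have h2 := hmax x hxe' _ (hseg (-δ) (by rw [abs_neg, abs_of_pos hδ]))
    simp at h1 h2
    nlinarith
  have hlb : l' b ≤ 0 := by
    have h1 := hmax x hxe' _ (hε' 0 (ε / 2) (by simpa using hε) (by positivity) (by linarith))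
    simp at h1
    nlinarith
  have hlb := IsEdge.functional_neg hl'0 hab.1 hla hlb
  have key : ∀ y ∈ Δ, (y ∈ e' ↔ y ∈ e) := by
    intro y hy
    have hyc : y = x + (cross a b * cross (y - x) b) • a + (cross a b * cross a (y - x)) • b := by
      rw [add_assoc, ← hab.1.eq_combination (y - x)]; abel
    set s := cross a b * cross (y - x) b
    set t := cross a b * cross a (y - x)
    have hval : l' y = l' x + t * l' b := by rw [hyc]; simp [hla]
    have h1 := (hab.coord hΔ hedge hxe (hyc ▸ hy)).2
    rw [← hyc] at h1
    rw [h1]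
    constructor
    · intro h
      have h2 := hmax y h x hx
      have h3 := hmax x hxe' y hy
      have h4 : t * l' b = 0 := by linarith
      exact (mul_eq_zero.1 h4).resolve_right hlb.ne
    · intro h
      exact hface x hxe' y hy (by rw [hval, h]; simp)
  ext y
  exact ⟨fun h => (key y (he'.subset h)).1 h, fun h => (key y h.1).2 h⟩

end

/-! ### Local expansions at exterior, interior, edge and vertex points -/

section

/-- The contribution of a vertex `v` to the coefficient of order `q + 1`. Here `z₁`, `z₂` are the
components of `w₂`, `w₁` transversal to the edges along `w₁`, `w₂`. -/
def vertexTerm (f : Plane → ℝ) (v w₁ w₂ z₁ z₂ : Plane) (η₁ η₂ : ℝ) (q : ℕ) : ℝ :=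
  cornerSum f v w₁ w₂ q - emCoeff (q + 1) *
    (η₁ * ∑ k ∈ Finset.range q, (dirDeriv z₁)^[k] ((dirDeriv w₂)^[q - 1 - k] f) v
      + η₂ * ∑ k ∈ Finset.range q, (dirDeriv z₂)^[k] ((dirDeriv w₁)^[q - 1 - k] f) v)

/-- The coefficients of the expansion of Riemann sums over a polygon; `z e` is a vector
transversal to the edge `e`. -/
def polygonCoeff (Δ : Set Plane) (w₁ w₂ : Plane → Plane) (a z : Set Plane → Plane)
    (η₁ η₂ : Plane → ℝ) (f : Plane → ℝ) : ℕ → ℝ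
  | 0 => ∫ x in Δ, f x
  | q + 1 => emCoeff (q + 1) * ∑ᶠ e ∈ edges Δ, starIntegral (a e) e ((dirDeriv (z e))^[q] f)
      + ∑ᶠ v ∈ vertices Δ, vertexTerm f v (w₁ v) (w₂ v) (z (edgeAlong Δ v (w₁ v)))
          (z (edgeAlong Δ v (w₂ v))) (η₁ v) (η₂ v) q

/-- A Delzant lattice polygon together with bases at its vertices and edges, and transversal
components `z e` of the second basis vectors at the edges. -/
structure IsPolygonFrame (Δ : Set Plane) (w₁ w₂ : Plane → Plane) (a b z : Set Plane → Plane)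
    (η : Set Plane → ℝ) (η₁ η₂ : Plane → ℝ) : Prop where
  polygon : IsDelzantLatticePolygon Δ
  vertex : ∀ v ∈ vertices Δ, IsVertexBasis Δ v (w₁ v) (w₂ v)
  edge : ∀ e ∈ edges Δ, IsEdgeBasis Δ e (a e) (b e)
  edge_eq : ∀ e ∈ edges Δ, b e = z e + η e • a e
  snd_eq : ∀ v ∈ vertices Δ, w₂ v = z (edgeAlong Δ v (w₁ v)) + η₁ v • w₁ v
  fst_eq : ∀ v ∈ vertices Δ, w₁ v = z (edgeAlong Δ v (w₂ v)) + η₂ v • w₂ v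
  norm_fst : ∀ v ∈ vertices Δ, ‖a (edgeAlong Δ v (w₁ v))‖ = ‖w₁ v‖
  norm_snd : ∀ v ∈ vertices Δ, ‖a (edgeAlong Δ v (w₂ v))‖ = ‖w₂ v‖

section vanishing

variable {f : Plane → ℝ} {v : Plane}

lemma dirDeriv_iterate_apply_eq_zero {x : Plane} (hx : x ∉ tsupport f) (u w : Plane) (k l : ℕ) :
    (dirDeriv u)^[k] ((dirDeriv w)^[l] f) x = 0 :=
  image_eq_zero_of_notMem_tsupport fun h =>
    hx (tsupport_dirDeriv_iterate_subset w f l (tsupport_dirDeriv_iterate_subset u _ k h))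

lemma cornerSum_eq_zero (hv : v ∉ tsupport f) (u w : Plane) (q : ℕ) : cornerSum f v u w q = 0 :=
  Finset.sum_eq_zero fun m _ => by rw [dirDeriv_iterate_apply_eq_zero hv, mul_zero]

lemma vertexTerm_eq_zero (hv : v ∉ tsupport f) (w₁ w₂ z₁ z₂ : Plane) (η₁ η₂ : ℝ) (q : ℕ) :
    vertexTerm f v w₁ w₂ z₁ z₂ η₁ η₂ q = 0 := by
  simp [vertexTerm, cornerSum_eq_zero hv, dirDeriv_iterate_apply_eq_zero hv]

lemma rayIntegral_eq_zero {w : Plane} {g : Plane → ℝ} (h : ∀ t : ℝ, g (v + t • w) = 0) :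
    rayIntegral v w g = 0 := by
  simp [rayIntegral, h]

lemma dirDeriv_iterate_eq_zero {x : Plane} (hx : x ∉ tsupport f) (u : Plane) (k : ℕ) :
    (dirDeriv u)^[k] f x = 0 :=
  image_eq_zero_of_notMem_tsupport fun h => hx (tsupport_dirDeriv_iterate_subset u _ k h)

end vanishing

lemma IsLatticeBasis.eventually_coord {u w : Plane} (hb : IsLatticeBasis u w) (x : Plane) {ε : ℝ}
    (hε : 0 < ε) :
    ∀ᶠ y in 𝓝 x, ∀ s t : ℝ, y = x + s • u + t • w → |s| < ε ∧ |t| < ε := by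
  have hc1 : Continuous fun y : Plane => |cross u w * cross (y - x) w| := by
    unfold cross; fun_prop
  have hc2 : Continuous fun y : Plane => |cross u w * cross u (y - x)| := by
    unfold cross; fun_prop
  have h1 := (hc1.tendsto x).eventually_lt_const (u := ε) (by simpa [cross] using hε)
  have h2 := (hc2.tendsto x).eventually_lt_const (u := ε) (by simpa [cross] using hε)
  filter_upwards [h1, h2] with y hy1 hy2 s t hst
  have e : y - x = s • u + t • w := by rw [hst]; abel
  rw [e, cross_add_smul_right, mul_left_comm, hb.cross_mul_self, mul_one] at hy1
  rw [e, cross_add_smul_left, mul_left_comm, hb.cross_mul_self, mul_one] at hy2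
  exact ⟨hy1, hy2⟩

lemma IsDelzantLatticePolygon.eventually_notMem_edges {Δ : Set Plane}
    (hΔ : IsDelzantLatticePolygon Δ) (x : Plane) :
    ∀ᶠ y in 𝓝 x, ∀ e ∈ edges Δ, x ∉ e → y ∉ e := by
  refine (eventually_all_finite (edges_finite hΔ)).2 fun e he => ?_
  by_cases hx : x ∈ e
  · simp [hx]
  · filter_upwards [(IsEdge.isCompact he hΔ).isClosed.isOpen_compl.mem_nhds hx] with y hy _ using hy

lemma IsDelzantLatticePolygon.eventually_notMem_vertices {Δ : Set Plane}
    (hΔ : IsDelzantLatticePolygon Δ) (x : Plane) :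
    ∀ᶠ y in 𝓝 x, ∀ v ∈ vertices Δ, x ≠ v → y ≠ v := by
  refine (eventually_all_finite hΔ.vertices_finite).2 fun v _ => ?_
  by_cases hx : x = v
  · simp [hx]
  · filter_upwards [isOpen_ne.mem_nhds hx] with y hy _ using hy

namespace IsPolygonFrame

variable {Δ : Set Plane} {w₁ w₂ : Plane → Plane} {a b z : Set Plane → Plane}
  {η : Set Plane → ℝ} {η₁ η₂ : Plane → ℝ} {x : Plane}

/-- The expansion holds for test functions supported close to `x`. -/
def ExpandsAt (Δ : Set Plane) (w₁ w₂ : Plane → Plane) (a z : Set Plane → Plane)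
    (η₁ η₂ : Plane → ℝ) (x : Plane) : Prop :=
  ∃ U ∈ 𝓝 x, ∀ f, IsTest f → tsupport f ⊆ U →
    HasExpansion (riemannSum Δ f) (polygonCoeff Δ w₁ w₂ a z η₁ η₂ f)

lemma measurableSet (h : IsPolygonFrame Δ w₁ w₂ a b z η η₁ η₂) : MeasurableSet Δ :=
  h.polygon.isCompact.isClosed.measurableSet

lemma star_eq_zero (h : IsPolygonFrame Δ w₁ w₂ a b z η η₁ η₂) {e : Set Plane} (he : e ∈ edges Δ)
    {f : Plane → ℝ} (hf : ∀ y ∈ tsupport f, y ∉ e) (u c : Plane) (q : ℕ) :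
    starIntegral c e ((dirDeriv u)^[q] f) = 0 :=
  starIntegral_eq_zero (fun y hy => dirDeriv_iterate_eq_zero (fun hy' => hf y hy' hy) u q)
    (IsEdge.measurableSet he h.polygon)

lemma polygonCoeff_eq_zero (h : IsPolygonFrame Δ w₁ w₂ a b z η η₁ η₂) {f : Plane → ℝ}
    (he : ∀ e ∈ edges Δ, ∀ y ∈ tsupport f, y ∉ e) (hv : ∀ v ∈ vertices Δ, v ∉ tsupport f) (q : ℕ) :
    polygonCoeff Δ w₁ w₂ a z η₁ η₂ f (q + 1) = 0 := by
  rw [polygonCoeff, finsum_mem_eq_zero_of_forall_eq_zero fun e he' => h.star_eq_zero he' (he e he') _ _ _,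
    finsum_mem_eq_zero_of_forall_eq_zero fun v hv' => vertexTerm_eq_zero (hv v hv') _ _ _ _ _ _ _]
  simp

lemma expandsAt_of_notMem (h : IsPolygonFrame Δ w₁ w₂ a b z η η₁ η₂) (hx : x ∉ Δ) :
    ExpandsAt Δ w₁ w₂ a z η₁ η₂ x := by
  refine ⟨Δᶜ, h.polygon.isCompact.isClosed.isOpen_compl.mem_nhds hx, fun f hf hU => ?_⟩
  have hzero : ∀ y ∈ Δ, f y = 0 := fun y hy =>
    image_eq_zero_of_notMem_tsupport fun hy' => hU hy' hy
  have hT : ∀ q, polygonCoeff Δ w₁ w₂ a z η₁ η₂ f q = 0 := by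
    rintro (_ | q)
    · rw [polygonCoeff, setIntegral_congr_fun h.measurableSet hzero]
      simp
    · exact h.polygonCoeff_eq_zero (fun e he y hy hye => hU hy (IsEdge.subset he hye))
        (fun v hv hv' => hU hv' hv.1) q
  intro Q
  refine (isBigO_zero _ _).congr' ?_ EventuallyEq.rfl
  filter_upwards [eventually_gt_atTop 0] with N hN
  have hN' : (N : ℝ) ≠ 0 := by positivity
  rw [riemannSum, finsum_mem_eq_zero_of_forall_eq_zero]
  · simp [hT]
  · rintro k ⟨-, hk⟩
    exact hzero _ ((Set.mem_smul_set_iff_inv_smul_mem₀ hN' _ _).1 hk)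

lemma exists_vertex (h : IsPolygonFrame Δ w₁ w₂ a b z η η₁ η₂) : ∃ v, v ∈ vertices Δ :=
  h.polygon.isCompact.extremePoints_nonempty h.polygon.nonempty

/-- A small step along `-b` from an interior point stays in `Δ`, but from an edge it leaves the
half-plane. -/
lemma notMem_edge_of_mem_interior (h : IsPolygonFrame Δ w₁ w₂ a b z η η₁ η₂) (hx : x ∈ interior Δ)
    {e : Set Plane} (he : e ∈ edges Δ) : x ∉ e := by
  intro hxe
  have hc : Continuous fun t : ℝ => x + (0 : ℝ) • a e + t • b e := by fun_prop
  have h1 : ∀ᶠ t in 𝓝 (0 : ℝ), x + (0 : ℝ) • a e + t • b e ∈ Δ :=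
    (hc.tendsto 0).eventually (by simpa using mem_interior_iff_mem_nhds.1 hx)
  obtain ⟨ε, hε, hball⟩ := Metric.eventually_nhds_iff.1 h1
  have h2 := hball (y := -(ε / 2)) (by simp [abs_of_pos hε, hε])
  have := ((h.edge e he).coord h.polygon he hxe h2).1
  linarith

lemma vertex_mem_edgeAlong {v : Plane} (hv : v ∈ vertices Δ) (w : Plane) : v ∈ edgeAlong Δ v w :=
  mem_edgeAlong_self hv.1

/-- The basis at any vertex serves: shifting that vertex by lattice vectors puts the support inside
the open quadrant, so no boundary term survives on either side. -/
lemma expandsAt_of_mem_interior (h : IsPolygonFrame Δ w₁ w₂ a b z η η₁ η₂) (hx : x ∈ interior Δ) :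
    ExpandsAt Δ w₁ w₂ a z η₁ η₂ x := by
  obtain ⟨v₀, hv₀⟩ := h.exists_vertex
  set u := w₁ v₀
  set w := w₂ v₀
  have hb : IsLatticeBasis u w := (h.vertex v₀ hv₀).1
  set s₀ := cross u w * cross (x - v₀) w
  set t₀ := cross u w * cross u (x - v₀)
  have hx₀ : x = v₀ + s₀ • u + t₀ • w := by
    rw [add_assoc, ← hb.eq_combination (x - v₀)]; abel
  -- Relative to the shifted corner both coordinates of `x` exceed `1`, and the support varies them
  -- by less than `1`.
  obtain ⟨M, hM⟩ := exists_nat_gt (max (1 - s₀) (1 - t₀))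
  have hM1 := (le_max_left _ _).trans_lt hM
  have hM2 := (le_max_right _ _).trans_lt hM
  set v := v₀ - (M : ℝ) • u - (M : ℝ) • w
  have hvI : v ∈ intPts := intPts_sub (intPts_sub (h.polygon.vertices_subset hv₀)
    (by exact_mod_cast intPts_smul hb.1 M)) (by exact_mod_cast intPts_smul hb.2.1 M)
  refine ⟨{y | y ∈ interior Δ ∧ ∀ s t : ℝ, y = x + s • u + t • w → |s| < 1 ∧ |t| < 1},
    (show ∀ᶠ y in 𝓝 x, y ∈ interior Δ from isOpen_interior.mem_nhds hx).and (hb.eventually_coord x one_pos), fun f hf hU => ?_⟩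
  have hpos : ∀ s t : ℝ, v + s • u + t • w ∈ tsupport f → 0 < s ∧ 0 < t := by
    intro s t hst
    have h1 := (hU hst).2 (s - M - s₀) (t - M - t₀) (by rw [hx₀]; module)
    have h2 := (abs_lt.1 h1.1).1
    have h3 := (abs_lt.1 h1.2).1
    exact ⟨by linarith, by linarith⟩
  have hagree : AgreesWithQuadrant Δ f v u w := fun s t hst =>
    ⟨fun _ => ⟨(hpos s t hst).1.le, (hpos s t hst).2.le⟩, fun _ => interior_subset (hU hst).1⟩
  refine (hagree.hasExpansion hb hvI h.measurableSet hf).congr (fun _ _ => rfl) fun q => ?_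
  rcases q with _ | q
  · rfl
  · have hu : ∀ t : ℝ, v + t • u ∉ tsupport f := fun t ht =>
      (hpos t 0 (by simpa using ht)).2.ne rfl
    have hw : ∀ t : ℝ, v + t • w ∉ tsupport f := fun t ht =>
      (hpos 0 t (by simpa using ht)).1.ne rfl
    rw [h.polygonCoeff_eq_zero (fun e he y hy => h.notMem_edge_of_mem_interior (hU hy).1 he)
      (fun v' hv' hmem => h.notMem_edge_of_mem_interior (hU hmem).1 (h.vertex v' hv').2.1
        (vertex_mem_edgeAlong hv' _)), quadrantCoeff,
      rayIntegral_eq_zero fun t => dirDeriv_iterate_eq_zero (hu t) _ _,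
      rayIntegral_eq_zero fun t => dirDeriv_iterate_eq_zero (hw t) _ _,
      cornerSum_eq_zero (by simpa using hu 0)]
    simp

/-- The corner is a vertex of the edge slid back along its line by lattice steps, so the support
meets only the ray along `a e`. Passing from `b e` to `z e` then leaves no end-point terms. -/
lemma expandsAt_of_mem_edge (h : IsPolygonFrame Δ w₁ w₂ a b z η η₁ η₂) (hx : x ∈ Δ)
    (hint : x ∉ interior Δ) (hvert : x ∉ vertices Δ) : ExpandsAt Δ w₁ w₂ a z η₁ η₂ x := by
  obtain ⟨e, he, hxe, hall⟩ := exists_edge_of_not_vertex h.polygon hx hint hvert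
  have hbasis := h.edge e he
  obtain ⟨⟨ε, hε, hhalf⟩, huniq⟩ := hall _ _ hbasis
  have hb := hbasis.1
  obtain ⟨v₀, hv₀, hv₀e⟩ := IsEdge.exists_vertex he h.polygon
  obtain ⟨s₀, hs₀⟩ := IsEdge.exists_eq_add_smul he hbasis.2.1 hb.fst_ne_zero hv₀e hxe
  obtain ⟨M, hM⟩ := exists_nat_gt (1 - s₀)
  set v := v₀ - (M : ℝ) • a e with hv_def
  have hvI : v ∈ intPts := intPts_sub (h.polygon.vertices_subset hv₀)
    (by exact_mod_cast intPts_smul hb.1 M)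
  refine ⟨{y | (∀ s t : ℝ, y = x + s • a e + t • b e → |s| < min 1 ε ∧ |t| < min 1 ε) ∧
      (∀ e ∈ edges Δ, x ∉ e → y ∉ e) ∧ ∀ v ∈ vertices Δ, x ≠ v → y ≠ v},
    (hb.eventually_coord x (lt_min one_pos hε)).and ((h.polygon.eventually_notMem_edges x).and
      (h.polygon.eventually_notMem_vertices x)), fun f hf hU => ?_⟩
  have hcoord : ∀ s t : ℝ, v + s • a e + t • b e = x + (s - M - s₀) • a e + t • b e := by
    intro s t; rw [hs₀]; module
  have hnear : ∀ s t : ℝ, v + s • a e + t • b e ∈ tsupport f →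
      0 < s ∧ |s - M - s₀| < ε ∧ |t| < ε := by
    intro s t hst
    have h1 := (hU hst).1 _ t (hcoord s t)
    have h2 := (abs_lt.1 (h1.1.trans_le (min_le_left _ _))).1
    exact ⟨by linarith, h1.1.trans_le (min_le_right _ _), h1.2.trans_le (min_le_right _ _)⟩
  have hagree : AgreesWithQuadrant Δ f v (a e) (b e) := by
    intro s t hst
    obtain ⟨h1, h2, h3⟩ := hnear s t hst
    rw [hcoord]
    refine ⟨fun hmem => ⟨h1.le, (hbasis.coord h.polygon he hxe hmem).1⟩, fun ht => ?_⟩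
    exact hhalf _ _ h2 ht.2 (abs_lt.1 h3).2
  refine (hagree.hasExpansion hb hvI h.measurableSet hf).congr (fun _ _ => rfl) fun q => ?_
  rcases q with _ | q
  · rfl
  · have hray : ∀ t : ℝ, v + t • b e ∉ tsupport f := fun t ht =>
      (hnear 0 t (by simpa using ht)).1.ne rfl
    have hv : v ∉ tsupport f := by simpa using hray 0
    have hedges : ∑ᶠ e' ∈ edges Δ, starIntegral (a e') e' ((dirDeriv (z e'))^[q] f)
        = starIntegral (a e) e ((dirDeriv (z e))^[q] f) := by
      rw [← finsum_mem_singleton (a := e)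
        (f := fun e' => starIntegral (a e') e' ((dirDeriv (z e'))^[q] f))]
      refine finsum_mem_inter_support_eq' _ _ _ fun e' he' => ⟨fun hmem => ?_, ?_⟩
      · by_contra hne
        refine he' (h.star_eq_zero hmem (fun y hy => (hU hy).2.1 e' hmem fun hxe' => ?_) _ _ _)
        exact hne (huniq e' hmem hxe')
      · rintro rfl
        exact he
    have hverts : ∀ v' ∈ vertices Δ, vertexTerm f v' (w₁ v') (w₂ v') (z (edgeAlong Δ v' (w₁ v')))
        (z (edgeAlong Δ v' (w₂ v'))) (η₁ v') (η₂ v') q = 0 := fun v' hv' =>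
      vertexTerm_eq_zero (fun hmem => (hU hmem).2.2 v' hv' (fun hxv => hvert (hxv ▸ hv')) rfl)
        _ _ _ _ _ _ _
    rw [polygonCoeff, quadrantCoeff, hedges, finsum_mem_eq_zero_of_forall_eq_zero hverts,
      cornerSum_eq_zero hv, rayIntegral_eq_zero (w := b e)
        fun t => dirDeriv_iterate_eq_zero (hray t) _ _,
      rayIntegral_dirDeriv_iterate hb.fst_ne_zero (h.edge_eq e he) hf,
      Finset.sum_eq_zero fun k _ => dirDeriv_iterate_apply_eq_zero hv _ _ _ _,
      starIntegral_eq_rayIntegral (v := v) hb.fst_ne_zero (IsEdge.measurableSet he h.polygon)]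
    · simp
    · intro y hy
      obtain ⟨t, rfl⟩ := IsEdge.exists_eq_add_smul he hbasis.2.1 hb.fst_ne_zero hv₀e hy
      exact ⟨t + M, by rw [hv_def]; module⟩
    · intro t ht
      have hmem : v + t • a e + (0 : ℝ) • b e ∈ tsupport f := by
        rw [zero_smul, add_zero]
        by_contra hcon
        exact ht (dirDeriv_iterate_eq_zero hcon _ _)
      obtain ⟨h1, h2, h3⟩ := hnear t 0 hmem
      refine ⟨fun _ => h1.le, fun _ => ?_⟩
      have h4 := hhalf _ 0 h2 le_rfl hε
      have h5 := (hbasis.coord h.polygon he hxe h4).2.2 rfl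
      rwa [← hcoord, zero_smul, add_zero] at h5

lemma starIntegral_edgeAlong (h : IsPolygonFrame Δ w₁ w₂ a b z η η₁ η₂) {v w w' c : Plane}
    (hb : IsVertexBasis Δ v w w') (hc : ‖c‖ = ‖w‖) {f g : Plane → ℝ}
    (hagree : AgreesWithQuadrant Δ f v w w') (hg : ∀ x, g x ≠ 0 → x ∈ tsupport f) :
    starIntegral c (edgeAlong Δ v w) g = rayIntegral v w g := by
  rw [starIntegral_congr_norm hc, starIntegral_eq_rayIntegral hb.1.fst_ne_zero
    (IsEdge.measurableSet hb.2.1 h.polygon)]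
  · rintro y ⟨-, t, -, rfl⟩
    exact ⟨t, rfl⟩
  · intro t ht
    have h1 := hagree t 0 (by simpa using hg _ ht)
    simp only [zero_smul, add_zero, le_refl, and_true] at h1
    refine ⟨fun hmem => h1.1 hmem.1, fun ht0 => ⟨h1.2 ht0, t, ht0, rfl⟩⟩

/-- The corner is `x` itself. The two ray integrals become the integrals over the two edges at `x`,
and the end-point terms from changing the transversal direction enter `vertexTerm`. -/
lemma expandsAt_of_mem_vertices (h : IsPolygonFrame Δ w₁ w₂ a b z η η₁ η₂) (hx : x ∈ vertices Δ) :
    ExpandsAt Δ w₁ w₂ a z η₁ η₂ x := by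
  have hbasis := h.vertex x hx
  have hb := hbasis.1
  obtain ⟨ε, hε, htri⟩ := hbasis.exists_triangle h.polygon hx.1
  refine ⟨{y | (∀ s t : ℝ, y = x + s • w₁ x + t • w₂ x → |s| < ε ∧ |t| < ε) ∧
      (∀ e ∈ edges Δ, x ∉ e → y ∉ e) ∧ ∀ v ∈ vertices Δ, x ≠ v → y ≠ v},
    (hb.eventually_coord x hε).and ((h.polygon.eventually_notMem_edges x).and
      (h.polygon.eventually_notMem_vertices x)), fun f hf hU => ?_⟩
  have hagree : AgreesWithQuadrant Δ f x (w₁ x) (w₂ x) := by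
    intro s t hst
    have h1 := (hU hst).1 s t rfl
    refine ⟨fun hmem => ⟨hbasis.fst_nonneg h.polygon hx.1 hmem,
      hbasis.snd_nonneg h.polygon hx.1 hmem⟩, fun h0 => ?_⟩
    exact htri s t h0.1 (abs_lt.1 h1.1).2 h0.2 (abs_lt.1 h1.2).2
  have hagree' : AgreesWithQuadrant Δ f x (w₂ x) (w₁ x) := by
    intro s t hst
    rw [add_right_comm] at hst ⊢
    rw [hagree t s hst, and_comm]
  refine (hagree.hasExpansion hb (h.polygon.vertices_subset hx) h.measurableSet hf).congr
    (fun _ _ => rfl) fun q => ?_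
  rcases q with _ | q
  · rfl
  · have hedges : ∑ᶠ e ∈ edges Δ, starIntegral (a e) e ((dirDeriv (z e))^[q] f)
        = ∑ᶠ e ∈ ({edgeAlong Δ x (w₁ x), edgeAlong Δ x (w₂ x)} : Set (Set Plane)),
          starIntegral (a e) e ((dirDeriv (z e))^[q] f) := by
      refine finsum_mem_inter_support_eq' _ _ _ fun e he => ⟨fun hmem => ?_, ?_⟩
      · by_contra hne
        refine he (h.star_eq_zero hmem (fun y hy => (hU hy).2.1 e hmem fun hxe => ?_) _ _ _)
        exact hne (hbasis.2.2.2 e hmem hxe)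
      · rintro (rfl | rfl)
        · exact hbasis.2.1
        · exact hbasis.2.2.1
    have hverts : ∑ᶠ v ∈ vertices Δ, vertexTerm f v (w₁ v) (w₂ v) (z (edgeAlong Δ v (w₁ v)))
          (z (edgeAlong Δ v (w₂ v))) (η₁ v) (η₂ v) q
        = vertexTerm f x (w₁ x) (w₂ x) (z (edgeAlong Δ x (w₁ x)))
          (z (edgeAlong Δ x (w₂ x))) (η₁ x) (η₂ x) q := by
      rw [← finsum_mem_singleton (a := x) (f := fun v => vertexTerm f v (w₁ v) (w₂ v)
        (z (edgeAlong Δ v (w₁ v))) (z (edgeAlong Δ v (w₂ v))) (η₁ v) (η₂ v) q)]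
      refine finsum_mem_inter_support_eq' _ _ _ fun v hv => ⟨fun hmem => ?_, ?_⟩
      · by_contra hne
        exact hv (vertexTerm_eq_zero (fun hvf => (hU hvf).2.2 v hmem (Ne.symm hne) rfl)
          _ _ _ _ _ _ _)
      · rintro rfl
        exact hx
    have hsupp : ∀ (u : Plane) y, (dirDeriv u)^[q] f y ≠ 0 → y ∈ tsupport f := fun u y hy => by
      by_contra hcon
      exact hy (dirDeriv_iterate_eq_zero hcon _ _)
    rw [polygonCoeff, quadrantCoeff, hedges, finsum_mem_pair hbasis.edgeAlong_ne, hverts,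
      h.starIntegral_edgeAlong hbasis (h.norm_fst x hx) hagree (hsupp _),
      h.starIntegral_edgeAlong hbasis.symm (h.norm_snd x hx) hagree' (hsupp _),
      rayIntegral_dirDeriv_iterate hb.fst_ne_zero (h.snd_eq x hx) hf,
      rayIntegral_dirDeriv_iterate hb.snd_ne_zero (h.fst_eq x hx) hf, vertexTerm]
    ring

lemma expandsAt (h : IsPolygonFrame Δ w₁ w₂ a b z η η₁ η₂) (x : Plane) :
    ExpandsAt Δ w₁ w₂ a z η₁ η₂ x := by
  by_cases hx : x ∈ Δ
  · by_cases hint : x ∈ interior Δ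
    · exact h.expandsAt_of_mem_interior hint
    · by_cases hvert : x ∈ vertices Δ
      · exact h.expandsAt_of_mem_vertices hvert
      · exact h.expandsAt_of_mem_edge hx hint hvert
  · exact h.expandsAt_of_notMem hx

end IsPolygonFrame

end

/-! ### From local to global, and independence of the choice of bases -/

section

lemma IsTest.add {f g : Plane → ℝ} (hf : IsTest f) (hg : IsTest g) : IsTest (f + g) :=
  ⟨hf.smooth.add hg.smooth, hf.compact.add hg.compact⟩

lemma HasExpansion.add {S S' T T' : ℕ → ℝ} (h : HasExpansion S T) (h' : HasExpansion S' T') :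
    HasExpansion (S + S') (T + T') := by
  intro Q
  refine ((h Q).add (h' Q)).congr_left fun N => ?_
  simp only [Pi.add_apply, add_mul, Finset.sum_add_distrib]
  ring

/-- By strong induction: once the lower coefficients agree, the difference of the next two is
`O(1/N)`, hence zero. -/
lemma HasExpansion.unique {S T T' : ℕ → ℝ} (h : HasExpansion S T) (h' : HasExpansion S T') :
    T = T' := by
  funext q
  induction q using Nat.strong_induction_on with
  | _ q ih =>
    have h1 := (h (q + 1)).sub (h' (q + 1))
    have h2 : (fun N : ℕ => (T' q - T q) * ((N : ℝ) ^ q)⁻¹) =O[atTop]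
        fun N : ℕ => ((N : ℝ) ^ (q + 1))⁻¹ := by
      refine h1.congr_left fun N => ?_
      rw [Finset.sum_range_succ, Finset.sum_range_succ,
        Finset.sum_congr rfl fun k hk => by rw [ih k (Finset.mem_range.1 hk)]]
      ring
    obtain ⟨C, hC⟩ := h2.bound
    have h3 : ∀ᶠ N : ℕ in atTop, |T' q - T q| ≤ C * (N : ℝ)⁻¹ := by
      filter_upwards [hC, eventually_gt_atTop 0] with N hN hN0
      have hpos : (0 : ℝ) < (N : ℝ) ^ q := by positivity
      rw [norm_mul, norm_inv, norm_inv, norm_pow, norm_pow, RCLike.norm_natCast, Real.norm_eq_abs,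
        pow_succ, mul_inv, mul_left_comm, mul_comm |_|] at hN
      exact le_of_mul_le_mul_left hN (by positivity)
    have h4 : Tendsto (fun N : ℕ => C * (N : ℝ)⁻¹) atTop (𝓝 0) := by
      simpa using tendsto_inv_atTop_nhds_zero_nat.const_mul C
    have h5 := ge_of_tendsto h4 h3
    have := abs_nonpos_iff.1 h5
    linarith

/-- Finiteness is what makes the `finsum` in `riemannSum` additive in `f`. -/
lemma finite_intPts_inter {K : Set Plane} (hK : IsCompact K) : (intPts ∩ K).Finite := by
  obtain ⟨B, hB⟩ := hK.isBounded.exists_norm_le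
  obtain ⟨M, hM⟩ := exists_nat_gt B
  refine ((Set.finite_Icc (fun _ : Fin 2 => -(M : ℤ)) (fun _ => (M : ℤ))).image
    fun m : Fin 2 → ℤ => (WithLp.toLp 2 fun i => (m i : ℝ) : Plane)).subset ?_
  rintro x ⟨hx, hxK⟩
  choose m hm using hx
  refine ⟨m, ?_, by ext i; simp [hm]⟩
  have hb : ∀ i, |m i| ≤ (M : ℤ) := by
    intro i
    have h1 : |x i| ≤ M := by
      have := (PiLp.norm_apply_le x i).trans (hB x hxK)
      rw [Real.norm_eq_abs] at this
      exact this.trans hM.le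
    rw [hm i] at h1
    have h2 : ((|m i| : ℤ) : ℝ) ≤ ((M : ℤ) : ℝ) := by push_cast; exact h1
    exact_mod_cast h2
  exact ⟨fun i => (abs_le.1 (hb i)).1, fun i => (abs_le.1 (hb i)).2⟩

lemma riemannSum_add {Δ : Set Plane} (hΔ : IsCompact Δ) (f g : Plane → ℝ) (N : ℕ) :
    riemannSum Δ (f + g) N = riemannSum Δ f N + riemannSum Δ g N := by
  rw [riemannSum, riemannSum, riemannSum, ← mul_add,
    ← finsum_mem_add_distrib (finite_intPts_inter (hΔ.smul (N : ℝ)))]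
  rfl

lemma cornerSum_add {f g : Plane → ℝ} (hf : IsTest f) (hg : IsTest g) (v u w : Plane) (q : ℕ) :
    cornerSum (f + g) v u w q = cornerSum f v u w q + cornerSum g v u w q := by
  rw [cornerSum, cornerSum, cornerSum, ← Finset.sum_add_distrib]
  refine Finset.sum_congr rfl fun m _ => ?_
  rw [dirDeriv_iterate_add hf.smooth hg.smooth,
    dirDeriv_iterate_add (hf.iterate _ _).smooth (hg.iterate _ _).smooth, Pi.add_apply, mul_add]

lemma vertexTerm_add {f g : Plane → ℝ} (hf : IsTest f) (hg : IsTest g) (v w₁ w₂ z₁ z₂ : Plane)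
    (η₁ η₂ : ℝ) (q : ℕ) :
    vertexTerm (f + g) v w₁ w₂ z₁ z₂ η₁ η₂ q
      = vertexTerm f v w₁ w₂ z₁ z₂ η₁ η₂ q + vertexTerm g v w₁ w₂ z₁ z₂ η₁ η₂ q := by
  have h : ∀ z w : Plane, ∑ k ∈ Finset.range q, (dirDeriv z)^[k] ((dirDeriv w)^[q - 1 - k] (f + g)) v
      = ∑ k ∈ Finset.range q, (dirDeriv z)^[k] ((dirDeriv w)^[q - 1 - k] f) v
        + ∑ k ∈ Finset.range q, (dirDeriv z)^[k] ((dirDeriv w)^[q - 1 - k] g) v := by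
    intro z w
    rw [← Finset.sum_add_distrib]
    refine Finset.sum_congr rfl fun m _ => ?_
    rw [dirDeriv_iterate_add hf.smooth hg.smooth,
      dirDeriv_iterate_add (hf.iterate _ _).smooth (hg.iterate _ _).smooth, Pi.add_apply]
  rw [vertexTerm, vertexTerm, vertexTerm, h, h, cornerSum_add hf hg]
  ring

namespace IsPolygonFrame

variable {Δ : Set Plane} {w₁ w₂ : Plane → Plane} {a b z : Set Plane → Plane}
  {η : Set Plane → ℝ} {η₁ η₂ : Plane → ℝ}

lemma polygonCoeff_add (h : IsPolygonFrame Δ w₁ w₂ a b z η η₁ η₂) {f g : Plane → ℝ}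
    (hf : IsTest f) (hg : IsTest g) :
    polygonCoeff Δ w₁ w₂ a z η₁ η₂ (f + g)
      = polygonCoeff Δ w₁ w₂ a z η₁ η₂ f + polygonCoeff Δ w₁ w₂ a z η₁ η₂ g := by
  funext q
  rcases q with _ | q
  · exact integral_add
      (hf.smooth.continuous.integrable_of_hasCompactSupport hf.compact).integrableOn
      (hg.smooth.continuous.integrable_of_hasCompactSupport hg.compact).integrableOn
  · have h1 : ∑ᶠ e ∈ edges Δ, starIntegral (a e) e ((dirDeriv (z e))^[q] (f + g))
        = ∑ᶠ e ∈ edges Δ, starIntegral (a e) e ((dirDeriv (z e))^[q] f)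
          + ∑ᶠ e ∈ edges Δ, starIntegral (a e) e ((dirDeriv (z e))^[q] g) := by
      rw [← finsum_mem_add_distrib (edges_finite h.polygon)]
      refine finsum_mem_congr rfl fun e he => ?_
      have hb := h.edge e he
      obtain ⟨p, hp⟩ := IsEdge.nonempty he
      rw [dirDeriv_iterate_add hf.smooth hg.smooth, starIntegral_add hb.1.fst_ne_zero
        (IsEdge.measurableSet he h.polygon)
        (fun x hx => IsEdge.exists_eq_add_smul he hb.2.1 hb.1.fst_ne_zero hp hx)
        (hf.iterate _ _) (hg.iterate _ _)]
    have h2 := finsum_mem_add_distrib (s := vertices Δ)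
      (f := fun v => vertexTerm f v (w₁ v) (w₂ v) (z (edgeAlong Δ v (w₁ v)))
        (z (edgeAlong Δ v (w₂ v))) (η₁ v) (η₂ v) q)
      (g := fun v => vertexTerm g v (w₁ v) (w₂ v) (z (edgeAlong Δ v (w₁ v)))
        (z (edgeAlong Δ v (w₂ v))) (η₁ v) (η₂ v) q) h.polygon.vertices_finite
    rw [Pi.add_apply, polygonCoeff, polygonCoeff, polygonCoeff, h1]
    simp only [vertexTerm_add hf hg]
    rw [h2]
    ring

/-- The expansion of Riemann sums over a Delzant lattice polygon. -/
theorem hasExpansion (h : IsPolygonFrame Δ w₁ w₂ a b z η η₁ η₂) {f : Plane → ℝ} (hf : IsTest f) :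
    HasExpansion (riemannSum Δ f) (polygonCoeff Δ w₁ w₂ a z η₁ η₂ f) := by
  choose U hU hexp using h.expandsAt
  -- Finitely many good neighbourhoods cover the support, and a subordinate partition of unity
  -- splits `f` into local test functions.
  obtain ⟨t, ht⟩ := IsCompact.elim_nhds_subcover' hf.compact
    (fun x _ => interior (U x)) (fun x _ => interior_mem_nhds.2 (hU x))
  obtain ⟨ρ, hρ⟩ := SmoothPartitionOfUnity.exists_isSubordinate (modelWithCornersSelf ℝ Plane)
    (isClosed_tsupport f) (fun x : t => interior (U x)) (fun _ => isOpen_interior)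
    (by simpa [Set.iUnion_subtype] using ht)
  have hρs : ∀ i, ContDiff ℝ ∞ (ρ i) := fun i => (ρ i).contMDiff.contDiff
  have htest : ∀ i, IsTest (fun x => ρ i x * f x) := fun i =>
    ⟨(hρs i).mul hf.smooth, hf.compact.mul_left⟩
  have hsum : f = ∑ i, fun x => ρ i x * f x := by
    ext x
    rw [Finset.sum_apply, ← Finset.sum_mul]
    by_cases hx : x ∈ tsupport f
    · have h1 := ρ.sum_eq_one hx
      rw [finsum_eq_sum_of_fintype] at h1
      rw [h1, one_mul]
    · rw [image_eq_zero_of_notMem_tsupport hx, mul_zero]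
  have key : ∀ s : Finset t, IsTest (∑ i ∈ s, fun x => ρ i x * f x) ∧
      HasExpansion (riemannSum Δ (∑ i ∈ s, fun x => ρ i x * f x))
        (polygonCoeff Δ w₁ w₂ a z η₁ η₂ (∑ i ∈ s, fun x => ρ i x * f x)) := by
    classical
    intro s
    induction s using Finset.induction_on with
    | empty =>
      have h0 : IsTest (0 : Plane → ℝ) := ⟨contDiff_const, HasCompactSupport.zero⟩
      exact ⟨h0, hexp 0 0 h0 (by simp [tsupport])⟩
    | insert i s hi ih =>
      rw [Finset.sum_insert hi, h.polygonCoeff_add (htest i) ih.1]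
      refine ⟨(htest i).add ih.1, ?_⟩
      have h1 := hexp i _ (htest i) ((tsupport_mul_subset_left.trans (hρ i)).trans interior_subset)
      refine (h1.add ih.2).congr (fun N _ => ?_) fun _ => rfl
      exact riemannSum_add h.polygon.isCompact _ _ N
  rw [hsum]
  exact (key Finset.univ).2

end IsPolygonFrame

lemma inner_eq_zero_of_outwardNormal {Δ e : Set Plane} {n a b : Plane} (hn : IsOutwardNormal Δ e n)
    (he : IsEdge Δ e) (hab : IsEdgeBasis Δ e a b) : ⟪n, a⟫_ℝ = 0 := by
  refine IsEdge.functional_eq_zero (l := innerSL ℝ n) (fun x hx y hy => ?_) hab.2.1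
  have := hn.2 x hx y (he.subset hy)
  rw [inner_sub_right] at this
  simpa using this

lemma IsPrimitive.ne_zero {n : Plane} (hn : IsPrimitive n) : n ≠ 0 := by
  rintro rfl
  have := hn.2 2 0 intPts_zero_mem (by simp)
  rw [Int.isUnit_iff] at this
  omega

/-- Orthogonal decomposition of a vector of the plane. -/
lemma eq_add_of_orthogonal {n a : Plane} (hn : n ≠ 0) (ha : a ≠ 0) (h : ⟪n, a⟫_ℝ = 0) (x : Plane) :
    x = (⟪x, n⟫_ℝ / ‖n‖ ^ 2) • n + (⟪a, x⟫_ℝ / ‖a‖ ^ 2) • a := by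
  have hn2 : ‖n‖ ^ 2 ≠ 0 := by simpa using hn
  have ha2 : ‖a‖ ^ 2 ≠ 0 := by simpa using ha
  have h' : ⟪a, n⟫_ℝ = 0 := by rw [real_inner_comm]; exact h
  set y := x - ((⟪x, n⟫_ℝ / ‖n‖ ^ 2) • n + (⟪a, x⟫_ℝ / ‖a‖ ^ 2) • a) with hy
  have h1 : ⟪y, n⟫_ℝ = 0 := by
    rw [hy, inner_sub_left, inner_add_left, inner_smul_left, inner_smul_left, h',
      real_inner_self_eq_norm_sq]
    simp only [conj_trivial]
    field_simp
    simp
  have h2 : ⟪y, a⟫_ℝ = 0 := by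
    rw [hy, inner_sub_left, inner_add_left, inner_smul_left, inner_smul_left, h,
      real_inner_self_eq_norm_sq, real_inner_comm]
    simp only [conj_trivial]
    field_simp
    simp
  -- Lagrange's identity: nonzero orthogonal vectors are independent.
  have hcross : cross n a ≠ 0 := by
    have h3 : cross n a ^ 2 + ⟪n, a⟫_ℝ ^ 2 = ‖n‖ ^ 2 * ‖a‖ ^ 2 := by
      simp only [cross, PiLp.inner_apply, EuclideanSpace.norm_sq_eq, Fin.sum_univ_two,
        Real.norm_eq_abs, sq_abs, RCLike.inner_apply, conj_trivial]
      ring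
    intro h4
    rw [h4, h] at h3
    simp at h3
    exact h3.elim hn ha
  have h3 : cross n a * ⟪y, y⟫_ℝ = 0 := by
    have := congrArg (fun x => ⟪y, x⟫_ℝ) (cross_smul_eq n a y)
    simp only [inner_smul_right, inner_add_right, h1, h2, mul_zero, add_zero] at this
    exact this
  have h4 : y = 0 := inner_self_eq_zero.1 ((mul_eq_zero.1 h3).resolve_left hcross)
  rw [hy, sub_eq_zero] at h4
  exact h4

/-- Edge bases are unique up to the sign of the first vector, and up to adding multiples of the
first vector to the second. -/
lemma IsEdgeBasis.unique {Δ e : Set Plane} {a b a' b' : Plane} (hΔ : IsDelzantLatticePolygon Δ)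
    (he : IsEdge Δ e) (h : IsEdgeBasis Δ e a b) (h' : IsEdgeBasis Δ e a' b') :
    ‖a‖ = ‖a'‖ ∧ ∃ c : ℝ, b' = b + c • a := by
  obtain ⟨l, h0, hmax, -⟩ := he.exists_functional hΔ
  obtain ⟨hla, hlb⟩ := h.functional he h0 hmax
  obtain ⟨hla', hlb'⟩ := h'.functional he h0 hmax
  obtain ⟨⟨i, j⟩, hij, -⟩ := h.1.2.2 a' h'.1.1
  obtain ⟨⟨k, m⟩, hkm, -⟩ := h.1.2.2 b' h'.1.2.1
  simp only at hij hkm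
  -- The exposing functional kills `a` and `a'` and is negative on `b` and `b'`, so the change of
  -- basis is triangular with `m > 0`; unimodularity forces `|i| = m = 1`.
  have hj : (j : ℝ) = 0 := by
    have := congrArg l hij
    simp [hla, hla'] at this
    exact_mod_cast this.resolve_right hlb.ne
  have hm : (0 : ℝ) < m := by
    have := congrArg l hkm
    simp [hla] at this
    nlinarith
  have hcross := cross_combination a b i j k m
  rw [← hij, ← hkm, hj, zero_mul, sub_zero] at hcross
  have habs : |(i : ℝ)| * |(m : ℝ)| = 1 := by
    have h1 : |cross a b| = 1 := by rcases h.1.cross_eq with h | h <;> simp [h]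
    have h2 : |cross a' b'| = 1 := by rcases h'.1.cross_eq with h | h <;> simp [h]
    rw [hcross, abs_mul, h1, mul_one, abs_mul] at h2
    exact h2
  have hunit : |i| * |m| = 1 := by exact_mod_cast habs
  have hi : |i| = 1 := Int.eq_one_of_mul_eq_one_right (abs_nonneg i) hunit
  have hm1 : |m| = 1 := Int.eq_one_of_mul_eq_one_left (abs_nonneg m) hunit
  have hm' : m = 1 := by
    rw [abs_of_pos (by exact_mod_cast hm)] at hm1
    exact hm1
  refine ⟨?_, k, by rw [hkm, hm']; simp [add_comm]⟩
  rw [hij, hj, zero_smul, add_zero, norm_smul, Real.norm_eq_abs,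
    (by exact_mod_cast hi : |(i : ℝ)| = 1), one_mul]

/-- The vector `ζ e • n e` is the component of `b e` normal to the edge. It is unchanged when a
multiple of `a e` is added to `b e`, so the basis vectors at both ends of the edge have this same
normal component. -/
lemma isPolygonFrame {Δ : Set Plane} (hΔ : IsDelzantLatticePolygon Δ) {w₁ w₂ : Plane → Plane}
    (hw : ∀ v ∈ vertices Δ, IsVertexBasis Δ v (w₁ v) (w₂ v)) {n : Set Plane → Plane}
    (hn : ∀ e ∈ edges Δ, IsOutwardNormal Δ e (n e)) {a b : Set Plane → Plane}
    (hab : ∀ e ∈ edges Δ, IsEdgeBasis Δ e (a e) (b e)) {η₁ η₂ : Plane → ℝ}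
    (hη₁ : ∀ v, η₁ v = ⟪w₁ v, w₂ v⟫_ℝ / ‖w₁ v‖ ^ 2)
    (hη₂ : ∀ v, η₂ v = ⟪w₁ v, w₂ v⟫_ℝ / ‖w₂ v‖ ^ 2)
    {ζ : Set Plane → ℝ} (hζ : ∀ e, ζ e = ⟪b e, n e⟫_ℝ / ‖n e‖ ^ 2) :
    IsPolygonFrame Δ w₁ w₂ a b (fun e => ζ e • n e) (fun e => ⟪a e, b e⟫_ℝ / ‖a e‖ ^ 2) η₁ η₂ := by
  have key : ∀ v w w', v ∈ vertices Δ → IsVertexBasis Δ v w w' →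
      ‖a (edgeAlong Δ v w)‖ = ‖w‖ ∧
      w' = ζ (edgeAlong Δ v w) • n (edgeAlong Δ v w) + (⟪w, w'⟫_ℝ / ‖w‖ ^ 2) • w := by
    intro v w w' hv hb
    have he := hb.2.1
    have hbasis := hb.isEdgeBasis hv.1
    obtain ⟨h1, c, hc⟩ := (hab _ he).unique hΔ he hbasis
    refine ⟨h1, ?_⟩
    have hn' := hn _ he
    have h2 := eq_add_of_orthogonal hn'.1.ne_zero hb.1.fst_ne_zero
      (inner_eq_zero_of_outwardNormal hn' he hbasis) w'
    have h3 : ⟪w', n (edgeAlong Δ v w)⟫_ℝ = ⟪b (edgeAlong Δ v w), n (edgeAlong Δ v w)⟫_ℝ := by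
      have h4 : ⟪a (edgeAlong Δ v w), n (edgeAlong Δ v w)⟫_ℝ = 0 := by
        rw [real_inner_comm]
        exact inner_eq_zero_of_outwardNormal hn' he (hab _ he)
      rw [hc, inner_add_left, inner_smul_left, h4, mul_zero, add_zero]
    rw [h3, ← hζ] at h2
    exact h2
  refine ⟨hΔ, hw, hab, fun e he => ?_, fun v hv => ?_, fun v hv => ?_, fun v hv => ?_, fun v hv => ?_⟩
  · have h1 := eq_add_of_orthogonal (hn e he).1.ne_zero (hab e he).1.fst_ne_zero
      (inner_eq_zero_of_outwardNormal (hn e he) he (hab e he)) (b e)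
    rw [← hζ] at h1
    exact h1
  · rw [hη₁]
    exact (key v _ _ hv (hw v hv)).2
  · rw [hη₂, real_inner_comm]
    exact (key v _ _ hv (hw v hv).symm).2
  · exact (key v _ _ hv (hw v hv)).1
  · exact (key v _ _ hv (hw v hv).symm).1

end

/-! ### Parity of the Bernoulli numbers and the explicit coefficients -/

section

lemma emCoeff_two_mul {p : ℕ} (hp : 1 ≤ p) :
    emCoeff (2 * p) = (-1) ^ p * (posBernoulli p / (2 * p).factorial) := by
  obtain ⟨p, rfl⟩ : ∃ k, p = k + 1 := ⟨p - 1, by omega⟩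
  have h : ((-1 : ℝ) ^ p) * (-1) ^ p = 1 := by rw [← mul_pow]; simp
  simp only [emCoeff, posBernoulli, Nat.add_sub_cancel, pow_succ]
  rw [if_neg (by omega)]
  linear_combination (bernoulli (2 * (p + 1)) / (2 * (p + 1)).factorial : ℝ) * h

lemma emCoeff_two : emCoeff 2 = -(1 / 12) := by
  norm_num [emCoeff, bernoulli_two, Nat.factorial]

lemma neg_one_pow_pred {p : ℕ} (hp : 1 ≤ p) : (-1 : ℝ) ^ (p - 1) = -(-1) ^ p := by
  obtain ⟨p, rfl⟩ : ∃ k, p = k + 1 := ⟨p - 1, by omega⟩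
  simp [pow_succ]

variable {f : Plane → ℝ} {v u w : Plane}

/-- Only the products of two even-index coefficients contribute to terms of even order. -/
lemma cornerSum_odd (hf : ContDiff ℝ ∞ f) {p : ℕ} (hp : 1 < p) :
    cornerSum f v u w (2 * p - 1) = (-1) ^ p * ∑ m ∈ Finset.Ico 1 p,
      posBernoulli m * posBernoulli (p - m) / ((2 * m).factorial * (2 * (p - m)).factorial) *
        mixedDeriv f v (2 * m - 1) u (2 * (p - m) - 1) w := by
  have hinj : Set.InjOn (fun m => 2 * m - 1) (Finset.Ico 1 p : Finset ℕ) := by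
    intro m hm m' hm' h
    simp at hm hm' h
    omega
  have hsub : (Finset.Ico 1 p).image (fun m => 2 * m - 1) ⊆ Finset.range (2 * p - 1) := by
    intro m hm
    simp only [Finset.mem_image, Finset.mem_Ico, Finset.mem_range] at hm ⊢
    omega
  rw [cornerSum, ← Finset.sum_subset hsub, Finset.sum_image hinj, Finset.mul_sum]
  · refine Finset.sum_congr rfl fun m hm => ?_
    rw [Finset.mem_Ico] at hm
    rw [(by omega : 2 * m - 1 + 1 = 2 * m), (by omega : 2 * p - 1 - (2 * m - 1) = 2 * (p - m)),
      (by omega : 2 * p - 1 - 1 - (2 * m - 1) = 2 * (p - m) - 1), emCoeff_two_mul hm.1,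
      emCoeff_two_mul (by omega), mixedDeriv_eq hf]
    have hpow : (-1 : ℝ) ^ p = (-1) ^ m * (-1) ^ (p - m) := by
      rw [← pow_add]; congr 1; omega
    rw [hpow]
    field_simp
  · intro m hm hm'
    simp only [Finset.mem_image, Finset.mem_Ico, Finset.mem_range, not_exists, not_and] at hm hm'
    -- An even `m` gives an odd index above `1` in one of the factors. For `m = 0` it is `2 * p -
    -- 1`, which is where `1 < p` matters: for `p = 1` the product `1/2 * 1/2` survives.
    rcases Nat.even_or_odd m with he | ho
    · rcases Nat.eq_zero_or_pos m with rfl | hpos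
      · rw [emCoeff_eq_zero (q := 2 * p - 1 - 0) ⟨p - 1, by omega⟩ (by omega)]
        simp
      · rw [emCoeff_eq_zero (q := m + 1) he.add_one (by omega)]
        simp
    · obtain ⟨k, hk⟩ := ho
      exact absurd (by omega) (hm' (k + 1) (by omega))

/-- The two indices add up to an odd number, so one of them is odd and must be `1`, with coefficient
`1/2`; this leaves the two extreme terms. -/
lemma cornerSum_even (hf : ContDiff ℝ ∞ f) {p : ℕ} (hp : 1 ≤ p) :
    cornerSum f v u w (2 * p) = (-1) ^ p * posBernoulli p / (2 * (2 * p).factorial) *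
      (pureDeriv f v (2 * p - 1) u + pureDeriv f v (2 * p - 1) w) := by
  have hsub : ({0, 2 * p - 1} : Finset ℕ) ⊆ Finset.range (2 * p) := by
    intro m hm
    simp at hm ⊢
    omega
  rw [cornerSum, ← Finset.sum_subset hsub, Finset.sum_pair (by omega)]
  · rw [(by omega : 2 * p - 1 + 1 = 2 * p), (by omega : 2 * p - (2 * p - 1) = 1), zero_add,
      Nat.sub_zero, Nat.sub_zero, Nat.sub_self, emCoeff_one, emCoeff_two_mul hp, pureDeriv_eq hf,
      pureDeriv_eq hf]
    simp only [Function.iterate_zero, id]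
    field_simp
    ring
  · intro m hm hm'
    simp only [Finset.mem_insert, Finset.mem_singleton, Finset.mem_range, not_or] at hm hm'
    rcases Nat.even_or_odd m with he | ho
    · rw [emCoeff_eq_zero (q := m + 1) he.add_one (by omega)]
      simp
    · obtain ⟨k, hk⟩ := ho
      rw [emCoeff_eq_zero (q := 2 * p - m) ⟨p - k - 1, by omega⟩ (by omega)]
      simp

lemma sum_transversal_eq (hf : ContDiff ℝ ∞ f) (c : ℝ) (q : ℕ) :
    ∑ k ∈ Finset.range q, (dirDeriv (c • u))^[k] ((dirDeriv w)^[q - 1 - k] f) v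
      = ∑ k ∈ Finset.range q, c ^ k * mixedDeriv f v k u (q - 1 - k) w := by
  refine Finset.sum_congr rfl fun k _ => ?_
  rw [dirDeriv_smul_iterate (contDiff_dirDeriv_iterate hf w _), mixedDeriv_eq hf]
  rfl

lemma starIntegral_transversal_eq (hf : ContDiff ℝ ∞ f) (a : Plane) (e : Set Plane) (c : ℝ) (q : ℕ) :
    starIntegral a e ((dirDeriv (c • u))^[q] f)
      = c ^ q * starIntegral a e fun x => pureDeriv f x q u := by
  rw [dirDeriv_smul_iterate hf, ← starIntegral_const_mul]
  simp only [pureDeriv_eq hf]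
  rfl

end

end EulerMaclaurin

end

/-! ### The main theorem -/

open EulerMaclaurin in
/-- Explicit coefficients of the asymptotic Euler–Maclaurin expansion of Riemann sums over a
Delzant lattice polygon `Δ`. At each vertex `v`, `(w₁ v, w₂ v)` is the basis of `ℤ²` directing the
two edges at `v`; at each edge `e`, `n e` is the primitive outward normal and `(a e, b e)` is a
basis of `ℤ²` with `a e` along `e` and `b e` pointing into `Δ`. -/
theorem mainTheorem3
    (Δ : Set Plane) (hΔ : IsDelzantLatticePolygon Δ)
    (w₁ w₂ : Plane → Plane) (hw : ∀ v ∈ vertices Δ, IsVertexBasis Δ v (w₁ v) (w₂ v))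
    (n : Set Plane → Plane) (hn : ∀ e ∈ edges Δ, IsOutwardNormal Δ e (n e))
    (a b : Set Plane → Plane) (hab : ∀ e ∈ edges Δ, IsEdgeBasis Δ e (a e) (b e))
    (η₁ η₂ μ : Plane → ℝ)
    (hη₁ : ∀ v, η₁ v = ⟪w₁ v, w₂ v⟫_ℝ / ‖w₁ v‖ ^ 2)
    (hη₂ : ∀ v, η₂ v = ⟪w₁ v, w₂ v⟫_ℝ / ‖w₂ v‖ ^ 2)
    (hμ : ∀ v, μ v = η₁ v + η₂ v)
    (ζ : Set Plane → ℝ) (hζ : ∀ e, ζ e = ⟪b e, n e⟫_ℝ / ‖n e‖ ^ 2)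
    (f : Plane → ℝ) (hf : ContDiff ℝ ∞ f) (hfc : HasCompactSupport f) :
    (∃ T : ℕ → ℝ, HasExpansion (riemannSum Δ f) T) ∧
    ∀ T : ℕ → ℝ, HasExpansion (riemannSum Δ f) T →
      T 0 = ∫ x in Δ, f x ∧
      T 1 = 1 / 2 * ∑ᶠ e ∈ edges Δ, starIntegral (a e) e f ∧
      T 2 = (∑ᶠ v ∈ vertices Δ, (1 / 4 + μ v / 12) * f v)
          - 1 / 12 * ∑ᶠ e ∈ edges Δ,
              ζ e * starIntegral (a e) e (fun x => fderiv ℝ f x (n e)) ∧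
      (∀ p : ℕ, 1 < p →
        T (2 * p) =
          (∑ᶠ e ∈ edges Δ,
            (-1) ^ p * (posBernoulli p / (2 * p).factorial) * ζ e ^ (2 * p - 1) *
              starIntegral (a e) e (fun x => pureDeriv f x (2 * p - 1) (n e)))
          + ∑ᶠ v ∈ vertices Δ,
            ((-1) ^ p * ∑ m ∈ Finset.Ico 1 p,
                posBernoulli m * posBernoulli (p - m) / ((2 * m).factorial * (2 * (p - m)).factorial) *
                  mixedDeriv f v (2 * m - 1) (w₁ v) (2 * (p - m) - 1) (w₂ v)
              + (-1) ^ (p - 1) * (posBernoulli p / (2 * p).factorial) * η₁ v *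
                ∑ k ∈ Finset.range (2 * p - 1),
                  ζ (edgeAlong Δ v (w₁ v)) ^ k *
                    mixedDeriv f v k (n (edgeAlong Δ v (w₁ v))) (2 * p - 2 - k) (w₂ v)
              + (-1) ^ (p - 1) * (posBernoulli p / (2 * p).factorial) * η₂ v *
                ∑ k ∈ Finset.range (2 * p - 1),
                  ζ (edgeAlong Δ v (w₂ v)) ^ k *
                    mixedDeriv f v k (n (edgeAlong Δ v (w₂ v))) (2 * p - 2 - k) (w₁ v))) ∧
      (∀ p : ℕ, 1 ≤ p →
        T (2 * p + 1) =
          (-1) ^ p * posBernoulli p / (2 * (2 * p).factorial) *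
            ∑ᶠ v ∈ vertices Δ,
              (pureDeriv f v (2 * p - 1) (w₁ v) + pureDeriv f v (2 * p - 1) (w₂ v))) := by
  have hframe := isPolygonFrame hΔ hw hn hab hη₁ hη₂ hζ
  have htest : IsTest f := ⟨hf, hfc⟩
  have hexp := hframe.hasExpansion htest
  refine ⟨⟨_, hexp⟩, fun T hT => ?_⟩
  rw [hT.unique hexp]
  refine ⟨rfl, ?_, ?_, fun p hp => ?_, fun p hp => ?_⟩
  · simp [polygonCoeff, vertexTerm, cornerSum, emCoeff_one]
  -- Order two is exceptional: the corner term is the square of `emCoeff 1`, that is `1/4`.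
  · rw [polygonCoeff, add_comm, emCoeff_two, sub_eq_add_neg, ← neg_mul]
    congr 1
    · refine finsum_mem_congr rfl fun v _ => ?_
      simp [vertexTerm, cornerSum, emCoeff_one, emCoeff_two, hμ]
      ring
    · congr 1
      refine finsum_mem_congr rfl fun e _ => ?_
      rw [starIntegral_transversal_eq hf, pow_one]
      simp only [pureDeriv_eq hf]
      rfl
  · obtain ⟨q, hq⟩ : ∃ q, 2 * p = q + 1 := ⟨2 * p - 1, by omega⟩
    have hq' : 2 * p - 1 = q := by omega
    have hc := emCoeff_two_mul hp.le
    rw [hq, polygonCoeff, ← hq, hc, mul_finsum_mem, hq']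
    congr 1
    · refine finsum_mem_congr rfl fun e _ => ?_
      rw [starIntegral_transversal_eq hf]
      ring
    · refine finsum_mem_congr rfl fun v _ => ?_
      rw [vertexTerm, ← hq', cornerSum_odd hf hp, sum_transversal_eq hf, sum_transversal_eq hf,
        neg_one_pow_pred hp.le, (by omega : 2 * p - 1 + 1 = 2 * p), hc]
      simp only [(by omega : 2 * p - 1 - 1 = 2 * p - 2)]
      ring
  -- In odd order above one the vanishing coefficient removes the edge integrals and the
  -- `η`-corrections together.
  · rw [polygonCoeff, emCoeff_eq_zero ⟨p, rfl⟩ (by omega), zero_mul, zero_add, mul_finsum_mem]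
    refine finsum_mem_congr rfl fun v _ => ?_
    rw [vertexTerm, cornerSum_even hf hp, emCoeff_eq_zero ⟨p, rfl⟩ (by omega)]
    ring
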